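/- Let $n\ge 2$, $x_{ij}=x_i-x_j$, $\partial_{ij}=\partial_i-\partial_j$ for $1\le i<j\le n$, and consider the partial differential operators with complex rational coefficients $$\Delta=\sum_{i=1}^n\partial_i^2,\qquad \tilde\Delta=\Delta-\sum_{1\le i<j\le n}4x_{ij}^{-2},\qquad \mathcal H=\sum_{i=1}^n(\partial_i^2-x_i),\qquad \tilde{\mathcal H}=\mathcal H-\sum_{1\le i<j\le n}4(x_i-x_j)^{-2}.$$ There is a nonzero partial differential operator $\mathcal D_n$ (the Chalykh–Veselov operator) that is a polynomial in the $\partial_{ij}$ with coefficients rational in the $x_{ij}$, satisfies $\mathcal D_n\Delta=\tilde\Delta\mathcal D_n$, and for which the function $$\tilde\phi(\vec x,\vec z)=\prod_{1\le i<j\le n}(z_i-z_j)^{-1}\,\mathcal D_n\big[\exp(x_1z_1+\cdots+x_nz_n)\big]$$ is symmetric: $\tilde\phi(\vec x,\vec z)=\tilde\phi(\vec z,\vec x)$. Every such operator, and more generally every operator $\mathcal D_n$ that is a polynomial in the $\partial_{ij}$ with coefficients rational in the $x_{ij}$ and satisfies $\mathcal D_n\Delta=\tilde\Delta\mathcal D_n$,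 satisfies $$\mathcal D_n\mathcal H=\tilde{\mathcal H}\mathcal D_n .$$ In particular $\mathcal H$ is intertwined with the rational operator $\tilde{\mathcal H}$ by a nonzero operator. -/

import Mathlib

noncomputable section

/-- The field `ℂ(x₁, …, xₙ)` of rational functions in `n` variables. -/
abbrev RatFun (n : ℕ) : Type := FractionRing (MvPolynomial (Fin n) ℂ)

namespace RatFun

variable {n : ℕ}

/-- The inclusion of polynomials into rational functions. -/
abbrev ofPoly (a : MvPolynomial (Fin n) ℂ) : RatFun n :=
  algebraMap (MvPolynomial (Fin n) ℂ) (RatFun n) a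

/-- The coordinate function `xᵢ`. -/
def x (i : Fin n) : RatFun n := ofPoly (MvPolynomial.X i)

/-- The quotient rule: `∂ᵢ (a / b) = (∂ᵢ a * b - a * ∂ᵢ b) / b ^ 2` for the reduced fraction
`a / b` that represents the given rational function. -/
def pderivFun (i : Fin n) (f : RatFun n) : RatFun n :=
  (ofPoly (MvPolynomial.pderiv i (IsFractionRing.num (MvPolynomial (Fin n) ℂ) f)) *
      ofPoly (IsFractionRing.den (MvPolynomial (Fin n) ℂ) f : MvPolynomial (Fin n) ℂ) -
    ofPoly (IsFractionRing.num (MvPolynomial (Fin n) ℂ) f) *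
      ofPoly (MvPolynomial.pderiv i
        (IsFractionRing.den (MvPolynomial (Fin n) ℂ) f : MvPolynomial (Fin n) ℂ))) /
    ofPoly (IsFractionRing.den (MvPolynomial (Fin n) ℂ) f : MvPolynomial (Fin n) ℂ) ^ 2

theorem ofPoly_ne_zero {b : MvPolynomial (Fin n) ℂ} (hb : b ≠ 0) : ofPoly b ≠ 0 :=
  (map_ne_zero_iff _ (IsFractionRing.injective (MvPolynomial (Fin n) ℂ) (RatFun n))).2 hb

/-- The quotient rule holds for every representing fraction, not only for the reduced one. -/
theorem pderivFun_div (i : Fin n) (a b : MvPolynomial (Fin n) ℂ) (hb : b ≠ 0) :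
    pderivFun i (ofPoly a / ofPoly b) =
      (ofPoly (MvPolynomial.pderiv i a) * ofPoly b -
        ofPoly a * ofPoly (MvPolynomial.pderiv i b)) / ofPoly b ^ 2 := by
  set f : RatFun n := ofPoly a / ofPoly b with hf
  set c := IsFractionRing.num (MvPolynomial (Fin n) ℂ) f with hc
  set d := (IsFractionRing.den (MvPolynomial (Fin n) ℂ) f : MvPolynomial (Fin n) ℂ) with hd
  have hd0 : d ≠ 0 := nonZeroDivisors.ne_zero (IsFractionRing.den _ f).2
  have hb' := ofPoly_ne_zero hb
  have hd' := ofPoly_ne_zero hd0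
  have hfcd : f = ofPoly c / ofPoly d := by
    have := IsFractionRing.mk'_num_den (MvPolynomial (Fin n) ℂ) f
    rw [IsFractionRing.mk'_eq_div] at this
    exact this.symm
  have h1 : ofPoly a * ofPoly d = ofPoly c * ofPoly b := by
    have := hf.symm.trans hfcd
    rwa [div_eq_div_iff hb' hd'] at this
  have h2 : a * d = c * b := by
    apply IsFractionRing.injective (MvPolynomial (Fin n) ℂ) (RatFun n)
    simpa only [map_mul] using h1
  have h3 := congrArg (fun p => ofPoly (MvPolynomial.pderiv i p)) h2
  simp only [Derivation.leibniz, smul_eq_mul, map_add, map_mul] at h3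
  have key : pderivFun i f = (ofPoly (MvPolynomial.pderiv i c) * ofPoly d -
      ofPoly c * ofPoly (MvPolynomial.pderiv i d)) / ofPoly d ^ 2 := rfl
  rw [key, div_eq_div_iff (pow_ne_zero 2 hd') (pow_ne_zero 2 hb')]
  linear_combination (-(ofPoly d * ofPoly b)) * h3 +
    (ofPoly d * ofPoly (MvPolynomial.pderiv i b) + ofPoly b * ofPoly (MvPolynomial.pderiv i d)) * h1

theorem exists_div (f : RatFun n) :
    ∃ a b : MvPolynomial (Fin n) ℂ, b ≠ 0 ∧ f = ofPoly a / ofPoly b := by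
  obtain ⟨a, b, hb, h⟩ := IsFractionRing.div_surjective (MvPolynomial (Fin n) ℂ) f
  exact ⟨a, b, nonZeroDivisors.ne_zero hb, h.symm⟩

theorem pderivFun_add (i : Fin n) (f g : RatFun n) :
    pderivFun i (f + g) = pderivFun i f + pderivFun i g := by
  obtain ⟨a, b, hb, rfl⟩ := exists_div f
  obtain ⟨c, d, hd, rfl⟩ := exists_div g
  have hb' := ofPoly_ne_zero hb
  have hd' := ofPoly_ne_zero hd
  have h : ofPoly a / ofPoly b + ofPoly c / ofPoly d = ofPoly (a * d + b * c) / ofPoly (b * d) := by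
    simp only [ofPoly, map_add, map_mul]
    exact div_add_div _ _ hb' hd'
  rw [h, pderivFun_div i _ _ (mul_ne_zero hb hd), pderivFun_div i _ _ hb, pderivFun_div i _ _ hd]
  simp only [Derivation.leibniz, smul_eq_mul, map_add, map_mul, ofPoly] at *
  field_simp
  ring

theorem pderivFun_mul (i : Fin n) (f g : RatFun n) :
    pderivFun i (f * g) = f * pderivFun i g + g * pderivFun i f := by
  obtain ⟨a, b, hb, rfl⟩ := exists_div f
  obtain ⟨c, d, hd, rfl⟩ := exists_div g
  have hb' := ofPoly_ne_zero hb
  have hd' := ofPoly_ne_zero hd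
  have h : ofPoly a / ofPoly b * (ofPoly c / ofPoly d) = ofPoly (a * c) / ofPoly (b * d) := by
    simp only [ofPoly, map_mul]
    exact div_mul_div_comm _ _ _ _
  rw [h, pderivFun_div i _ _ (mul_ne_zero hb hd), pderivFun_div i _ _ hb, pderivFun_div i _ _ hd]
  simp only [Derivation.leibniz, smul_eq_mul, map_add, map_mul, ofPoly] at *
  field_simp
  ring

theorem pderivFun_algebraMap (i : Fin n) (r : ℂ) :
    pderivFun i (algebraMap ℂ (RatFun n) r) = 0 := by
  have h : algebraMap ℂ (RatFun n) r = ofPoly (MvPolynomial.C r) / ofPoly 1 := by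
    simp only [ofPoly, map_one, div_one]
    rfl
  rw [h, pderivFun_div i _ _ one_ne_zero]
  simp [ofPoly]

/-- The partial derivative `∂ᵢ = ∂/∂xᵢ`, as a linear operator on rational functions. -/
def pd (i : Fin n) : Module.End ℂ (RatFun n) where
  toFun := pderivFun i
  map_add' := pderivFun_add i
  map_smul' r f := by
    rw [Algebra.smul_def, pderivFun_mul, pderivFun_algebraMap, mul_zero, add_zero,
      RingHom.id_apply, Algebra.smul_def]

/-- The operator of multiplication by the rational function `f`. -/
def mulOp (f : RatFun n) : Module.End ℂ (RatFun n) := LinearMap.mulLeft ℂ f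

variable (n) in
/-- The field of the rational functions of the differences `x_{ij} = xᵢ - xⱼ`. -/
def diffField : IntermediateField ℂ (RatFun n) :=
  IntermediateField.adjoin ℂ (Set.range fun p : Fin n × Fin n => x p.1 - x p.2)

end RatFun

/-- The pairs `(i, j)` with `i < j`. -/
abbrev OrdPair (n : ℕ) : Type := {p : Fin n × Fin n // p.1 < p.2}

/-- A partial differential operator `∑ₐ cₐ(x) ∂₁^{a₁} ⋯ ∂ₙ^{aₙ}` with rational coefficients,
recorded by its full symbol `∑ₐ cₐ(x) ξ₁^{a₁} ⋯ ξₙ^{aₙ}`. -/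
abbrev DiffOp (n : ℕ) : Type := MvPolynomial (Fin n) (RatFun n)

namespace DiffOp

open RatFun

variable {n : ℕ}

/-- The operator `∑ₐ cₐ(x) ∂₁^{a₁} ⋯ ∂ₙ^{aₙ}` itself, acting on `ℂ(x₁, …, xₙ)`. A differential
operator with rational coefficients is determined by this action, and products of operators are
compositions. -/
def toEnd (D : DiffOp n) : Module.End ℂ (RatFun n) :=
  ∑ a ∈ D.support, mulOp (D.coeff a) * (List.ofFn fun i => pd i ^ a i).prod

/-- `D` is a polynomial in the `∂_{ij} = ∂ᵢ - ∂ⱼ` whose coefficients are rational functions of the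
`x_{ij} = xᵢ - xⱼ` (`i < j`). -/
def IsPolyInDifferences (D : DiffOp n) : Prop :=
  ∃ P : MvPolynomial (OrdPair n) (diffField n),
    D = MvPolynomial.eval₂ (MvPolynomial.C.comp (algebraMap (diffField n) (RatFun n)))
      (fun p => MvPolynomial.X p.1.1 - MvPolynomial.X p.1.2) P

end DiffOp

namespace Airy

open RatFun

/-- `Δ = ∑ᵢ ∂ᵢ²`. -/
def lap (n : ℕ) : Module.End ℂ (RatFun n) := ∑ i, pd i ^ 2

/-- `∑_{i<j} 4 (xᵢ - xⱼ)⁻²`, as a multiplication operator. -/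
def pot (n : ℕ) : Module.End ℂ (RatFun n) :=
  ∑ p : OrdPair n, mulOp (4 * ((x p.1.1 - x p.1.2) ^ 2)⁻¹)

/-- `Δ̃ = Δ - ∑_{i<j} 4 (xᵢ - xⱼ)⁻²`. -/
def lapTilde (n : ℕ) : Module.End ℂ (RatFun n) := lap n - pot n

/-- `H = ∑ᵢ (∂ᵢ² - xᵢ)`. -/
def ham (n : ℕ) : Module.End ℂ (RatFun n) := ∑ i, (pd i ^ 2 - mulOp (x i))

/-- `H̃ = H - ∑_{i<j} 4 (xᵢ - xⱼ)⁻²`. -/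
def hamTilde (n : ℕ) : Module.End ℂ (RatFun n) := ham n - pot n

end Airy

/-- The field `ℂ(x₁, …, xₙ, z₁, …, zₙ)`; `Sum.inl i` stands for `xᵢ` and `Sum.inr i` for `zᵢ`. -/
abbrev RatFun₂ (n : ℕ) : Type := FractionRing (MvPolynomial (Fin n ⊕ Fin n) ℂ)

namespace RatFun₂

variable {n : ℕ}

/-- The variable `zᵢ`. -/
def z (i : Fin n) : RatFun₂ n :=
  algebraMap (MvPolynomial (Fin n ⊕ Fin n) ℂ) (RatFun₂ n) (MvPolynomial.X (Sum.inr i))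

/-- The inclusion `ℂ(x) → ℂ(x, z)`. -/
def ofX : RatFun n →+* RatFun₂ n :=
  IsFractionRing.map (A := MvPolynomial (Fin n) ℂ) (B := MvPolynomial (Fin n ⊕ Fin n) ℂ)
    (j := (MvPolynomial.rename Sum.inl : _ →ₐ[ℂ] MvPolynomial (Fin n ⊕ Fin n) ℂ).toRingHom)
    (MvPolynomial.rename_injective _ Sum.inl_injective)

/-- The exchange of the `x`-variables and the `z`-variables. -/
def swap : RatFun₂ n ≃+* RatFun₂ n :=
  IsFractionRing.ringEquivOfRingEquiv
    (MvPolynomial.renameEquiv ℂ (Equiv.sumComm (Fin n) (Fin n))).toRingEquiv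

end RatFun₂

namespace DiffOp

open RatFun₂

variable {n : ℕ}

/-- The function `φ̃(x,z) = ∏_{i<j} (zᵢ - zⱼ)⁻¹ · D[exp (∑ᵢ xᵢ zᵢ)]`, divided by
`exp (∑ᵢ xᵢ zᵢ)`. As `D[exp (∑ᵢ xᵢ zᵢ)] = D(x,z) exp (∑ᵢ xᵢ zᵢ)`, where `D(x,z)` is the symbol
with `zᵢ` in place of `∂ᵢ`, it is a rational function of `(x,z)`. -/
def waveFactor (D : DiffOp n) : RatFun₂ n :=
  (∏ p : OrdPair n, (z p.1.1 - z p.1.2)⁻¹) * MvPolynomial.eval₂ ofX z D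

/-- The properties that single out the Chalykh–Veselov operator: it is a nonzero polynomial in the
`∂_{ij}` with coefficients rational in the `x_{ij}`, it intertwines `Δ` and `Δ̃`, and the function
`φ̃` is symmetric under the exchange of `x` and `z` (as `exp (∑ᵢ xᵢ zᵢ)` is symmetric, this is the
symmetry of the factor). -/
structure IsChalykhVeselov (D : DiffOp n) : Prop where
  ne_zero : D.toEnd ≠ 0
  poly : D.IsPolyInDifferences
  intertwines : D.toEnd * Airy.lap n = Airy.lapTilde n * D.toEnd
  symm : swap D.waveFactor = D.waveFactor

end DiffOp

end

noncomputable section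

/-! ### Partial derivatives and multiplications as operators on ℂ(x) -/

namespace RatFun

variable {n : ℕ}

/-! The intertwining of the Airy Hamiltonians is short. `H` and `H̃` arise from `Δ` and `Δ̃` by
subtracting the same function `∑ xᵢ`. The commutator of an operator with `xᵢ` is the derivative of
its symbol in `ξᵢ`, and `∑ ∂/∂ξᵢ` kills every polynomial in the `ξᵢ - ξⱼ`. So the operator commutes
with `∑ xᵢ` (`IsPolyInDifferences.commute`).

The work lies in constructing a Chalykh–Veselov operator. Let `A = ∏_{i<j} (xᵢ - xⱼ)` and let `M` be
the number of pairs. Since `Δ̃ A⁻¹ = 0` (`vand_identity`), the operator `A² Δ̃ A⁻¹` is `A Δ - 2 ∑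
(∂ᵢA) ∂ᵢ`. On symbols, `∂ᵢ` from the left acts as `Dᵢ = ∂/∂xᵢ + zᵢ`, and from the right as `zᵢ`.
Hence `f / A` is the symbol of an intertwiner when `opM f = 0`.

A solution comes from the iteration `Q₀ = A²`, `Q_{j+1} = A⁻¹ opM Q_j`. Quasi-invariance keeps it
polynomial (`IsQuasiInvariant.exists_step`). The leading part of `Q_j` in `x` is `2^j A (∑ zᵢ
∂/∂xᵢ)^j A`, which vanishes for `j > M`; from there on the degrees fall until `Q` is zero. Since
`opM` is injective on `x`-degree below `M` (`eq_zero_of_opM_eq_zero`), already `Q_{M+1} = 0`, so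
`opM Q_M = 0`. The leading part of `Q_M` is `2^M M! A(x) A(z)`, so `Q_M` is nonzero.

Symmetry of `Q_M` is bispectrality. The exchanged operator `conj opM` maps `Q_M` into the kernel of
`opM` (`opM_conj_opM`). The two leading terms of `Q_M` are explicit and symmetric, which forces the
image to have degree below `M`, hence to vanish. Then `Q_M` and its exchange are both solutions,
with the same leading part, and injectivity identifies them. -/

theorem pd_ofPoly (i : Fin n) (a : MvPolynomial (Fin n) ℂ) :
    pd i (ofPoly a) = ofPoly (MvPolynomial.pderiv i a) := by
  have h := pderivFun_div i a 1 one_ne_zero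
  simpa [ofPoly, pd] using h

theorem pd_mul (i : Fin n) (f g : RatFun n) : pd i (f * g) = f * pd i g + g * pd i f :=
  pderivFun_mul i f g

variable (n) in
/-- The partial derivative as a derivation of the field of rational functions. -/
def pdDer (i : Fin n) : Derivation ℂ (RatFun n) (RatFun n) :=
  Derivation.mk' (pd i) fun a b => by simpa using pd_mul i a b

/-- A derivation of the field of rational functions that kills the polynomials vanishes. -/
theorem derivation_eq_zero (δ : Derivation ℂ (RatFun n) (RatFun n))
    (h : ∀ a : MvPolynomial (Fin n) ℂ, δ (ofPoly a) = 0) (f : RatFun n) : δ f = 0 := by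
  obtain ⟨a, b, hb, rfl⟩ := exists_div f
  have hb' := ofPoly_ne_zero hb
  have h1 : δ (ofPoly a / ofPoly b * ofPoly b) = 0 := by
    rw [div_mul_cancel₀ _ hb']; exact h a
  rw [Derivation.leibniz, h b, smul_zero, zero_add, smul_eq_mul] at h1
  exact (mul_eq_zero.1 h1).resolve_left hb'

theorem pderiv_comm {σ R : Type*} [CommRing R] (i j : σ) (a : MvPolynomial σ R) :
    MvPolynomial.pderiv i (MvPolynomial.pderiv j a) =
      MvPolynomial.pderiv j (MvPolynomial.pderiv i a) := by
  classical
  let d (k : σ) : Derivation R (MvPolynomial σ R) (MvPolynomial σ R) := MvPolynomial.pderiv k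
  have h : ⁅d i, d j⁆ = 0 := by
    apply MvPolynomial.derivation_ext
    intro k
    simp only [Derivation.commutator_apply, d, MvPolynomial.pderiv_X, Derivation.zero_apply]
    simp [Pi.single_apply, apply_ite]
  have h2 := congrArg (fun d => d a) h
  simp only [Derivation.commutator_apply, Derivation.zero_apply] at h2
  exact sub_eq_zero.1 h2

/-- The bracket of two derivations is a derivation, and this one vanishes on polynomials. -/
theorem pd_comm (i j : Fin n) : Commute (pd i) (pd j) := by
  have h := derivation_eq_zero ⁅pdDer n i, pdDer n j⁆ fun a => by
    simp only [Derivation.commutator_apply]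
    change pd i (pd j (ofPoly a)) - pd j (pd i (ofPoly a)) = 0
    simp only [pd_ofPoly, pderiv_comm i j, sub_self]
  refine LinearMap.ext fun f => ?_
  exact sub_eq_zero.1 (h f)

theorem pd_mulOp (i : Fin n) (f : RatFun n) :
    pd i * mulOp f = mulOp f * pd i + mulOp (pd i f) := by
  refine LinearMap.ext fun g => ?_
  change pd i (f * g) = f * pd i g + pd i f * g
  rw [pd_mul, mul_comm g]

theorem mulOp_mul (f g : RatFun n) : mulOp (f * g) = mulOp f * mulOp g :=
  LinearMap.ext fun h => mul_assoc f g h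

theorem mulOp_add (f g : RatFun n) : mulOp (f + g) = mulOp f + mulOp g :=
  LinearMap.ext fun h => add_mul f g h

theorem mulOp_zero : mulOp (0 : RatFun n) = 0 := LinearMap.ext fun h => zero_mul h

theorem mulOp_one : mulOp (1 : RatFun n) = 1 := LinearMap.ext fun h => one_mul h

theorem mulOp_sum {ι : Type*} (s : Finset ι) (f : ι → RatFun n) :
    mulOp (∑ i ∈ s, f i) = ∑ i ∈ s, mulOp (f i) := by
  refine LinearMap.ext fun h => ?_
  rw [LinearMap.sum_apply]
  exact Finset.sum_mul s f h

theorem mulOp_comm (f g : RatFun n) : mulOp f * mulOp g = mulOp g * mulOp f := by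
  rw [← mulOp_mul, mul_comm, mulOp_mul]

theorem pd_x (i j : Fin n) : pd i (x j) = if j = i then 1 else 0 := by
  classical
  rw [x, pd_ofPoly, MvPolynomial.pderiv_X, Pi.single_apply]
  split_ifs <;> simp [ofPoly]

variable (n) in
/-- The subalgebra of differential operators with constant coefficients. -/
abbrev constOps : Subalgebra ℂ (Module.End ℂ (RatFun n)) :=
  Algebra.adjoin ℂ (Set.range (pd (n := n)))

instance : IsMulCommutative (constOps n) :=
  Algebra.isMulCommutative_adjoin ℂ (by rintro _ ⟨i, rfl⟩ _ ⟨j, rfl⟩; exact pd_comm i j)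

open scoped IsMulCommutative in
instance : CommRing (constOps n) := inferInstance

/-- The monomial `∂₁^{a₁} ⋯ ∂ₙ^{aₙ}`. -/
def pdPow (a : Fin n →₀ ℕ) : Module.End ℂ (RatFun n) := (List.ofFn fun i => pd i ^ a i).prod

/-- Moves the ordered product into the commutative algebra generated by the `∂ᵢ`, where exponents
add freely. -/
theorem pdPow_eq (a : Fin n →₀ ℕ) :
    pdPow a = ((∏ i, (⟨pd i, Algebra.subset_adjoin ⟨i, rfl⟩⟩ : constOps n) ^ a i : constOps n) :
      Module.End ℂ (RatFun n)) := by
  rw [← List.prod_ofFn, pdPow]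
  change _ = (constOps n).subtype _
  rw [map_list_prod, List.map_ofFn]
  rfl

theorem pdPow_add (a b : Fin n →₀ ℕ) : pdPow (a + b) = pdPow a * pdPow b := by
  simp only [pdPow_eq, Finsupp.add_apply, pow_add, Finset.prod_mul_distrib]
  rfl

theorem pdPow_zero : pdPow (0 : Fin n →₀ ℕ) = 1 := by
  simp only [pdPow_eq, Finsupp.coe_zero, Pi.zero_apply, pow_zero, Finset.prod_const_one]
  rfl

theorem pdPow_single (i : Fin n) : pdPow (Finsupp.single i 1) = pd i := by
  classical
  rw [pdPow_eq, Finset.prod_eq_single i]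
  · simp
  · intro j _ hj
    rw [Finsupp.single_eq_of_ne hj, pow_zero]
  · simp

end RatFun

/-! ### Symbols and the operators they define -/

namespace DiffOp

open RatFun

variable {n : ℕ}

theorem toEnd_eq_sum (D : DiffOp n) {s : Finset (Fin n →₀ ℕ)} (hs : D.support ⊆ s) :
    D.toEnd = ∑ a ∈ s, mulOp (D.coeff a) * pdPow a :=
  Finset.sum_subset hs fun a _ ha => by
    rw [MvPolynomial.notMem_support_iff.1 ha, mulOp_zero, zero_mul]

theorem toEnd_add (D E : DiffOp n) : (D + E).toEnd = D.toEnd + E.toEnd := by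
  classical
  rw [toEnd_eq_sum _ MvPolynomial.support_add, toEnd_eq_sum D Finset.subset_union_left,
    toEnd_eq_sum E Finset.subset_union_right, ← Finset.sum_add_distrib]
  exact Finset.sum_congr rfl fun a _ => by rw [MvPolynomial.coeff_add, mulOp_add, add_mul]

theorem toEnd_zero : (0 : DiffOp n).toEnd = 0 := by simp [toEnd]

/-- `toEnd` as an additive homomorphism. -/
def toEndHom : DiffOp n →+ Module.End ℂ (RatFun n) where
  toFun := toEnd
  map_zero' := toEnd_zero
  map_add' := toEnd_add

theorem toEnd_sub (D E : DiffOp n) : (D - E).toEnd = D.toEnd - E.toEnd := map_sub toEndHom D E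

theorem toEnd_sum {ι : Type*} (s : Finset ι) (D : ι → DiffOp n) :
    (∑ i ∈ s, D i).toEnd = ∑ i ∈ s, (D i).toEnd := map_sum toEndHom D s

theorem toEnd_monomial (a : Fin n →₀ ℕ) (c : RatFun n) :
    toEnd (MvPolynomial.monomial a c) = mulOp c * pdPow a := by
  classical
  rw [toEnd_eq_sum _ (s := {a}) MvPolynomial.support_monomial_subset, Finset.sum_singleton,
    MvPolynomial.coeff_monomial, if_pos rfl]

theorem toEnd_C_mul (c : RatFun n) (D : DiffOp n) :
    toEnd (MvPolynomial.C c * D) = mulOp c * D.toEnd := by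
  induction D using MvPolynomial.induction_on' with
  | monomial a d => rw [MvPolynomial.C_mul_monomial, toEnd_monomial, toEnd_monomial, mulOp_mul,
      mul_assoc]
  | add D E hD hE => rw [mul_add, toEnd_add, toEnd_add, hD, hE, mul_add]

theorem toEnd_C (c : RatFun n) : toEnd (MvPolynomial.C c) = mulOp c := by
  rw [MvPolynomial.C_apply, toEnd_monomial, pdPow_zero, mul_one]

theorem toEnd_mul_X (D : DiffOp n) (i : Fin n) :
    toEnd (D * MvPolynomial.X i) = D.toEnd * pd i := by
  induction D using MvPolynomial.induction_on' with
  | monomial a d => rw [MvPolynomial.X, MvPolynomial.monomial_mul, toEnd_monomial, toEnd_monomial,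
      pdPow_add, pdPow_single, mul_one, mul_assoc]
  | add D E hD hE => rw [add_mul, toEnd_add, toEnd_add, hD, hE, add_mul]

/-- The commutator with a coordinate function is the derivative of the symbol. -/
theorem toEnd_mulOp_x (D : DiffOp n) (i : Fin n) :
    D.toEnd * mulOp (x i) = mulOp (x i) * D.toEnd + toEnd (MvPolynomial.pderiv i D) := by
  classical
  induction D using MvPolynomial.induction_on with
  | C c => rw [toEnd_C, MvPolynomial.pderiv_C, toEnd_zero, add_zero, mulOp_comm]
  | add D E hD hE => rw [map_add, toEnd_add, toEnd_add, add_mul, hD, hE, mul_add]; abel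
  | mul_X D j hD =>
    rw [toEnd_mul_X, mul_assoc, pd_mulOp, mul_add, ← mul_assoc, hD, Derivation.leibniz,
      MvPolynomial.pderiv_X, toEnd_add, add_mul, pd_x, smul_eq_mul, smul_eq_mul,
      mul_comm (MvPolynomial.X j), toEnd_mul_X, Pi.single_apply, mul_assoc]
    by_cases h : j = i
    · subst h
      simp only [if_true, mulOp_one, mul_one]
      abel
    · rw [if_neg h, if_neg (Ne.symm h), mulOp_zero, mul_zero, mul_zero, toEnd_zero]
      abel

/-- Commuting a zero operator with `xᵢ` shows that the symbol derivatives also give zero operators,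
and these have lower degree. By induction they vanish, so in characteristic zero the symbol is free
of `ξ`; its value is read off by applying the operator to `1`. -/
theorem toEnd_injective_aux (N : ℕ) (D : DiffOp n) (hN : D.totalDegree ≤ N) (h : D.toEnd = 0) :
    D = 0 := by
  classical
  induction N generalizing D with
  | zero =>
    rw [Nat.le_zero, MvPolynomial.totalDegree_eq_zero_iff_eq_C] at hN
    rw [hN, toEnd_C] at h
    have := LinearMap.congr_fun h 1
    rw [hN]
    have h2 : D.coeff 0 * 1 = 0 := this
    rw [mul_one] at h2
    rw [h2, map_zero]
  | succ N ih =>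
    have hp : ∀ i, MvPolynomial.pderiv i D = 0 := by
      intro i
      apply ih
      · refine Finset.sup_le fun m hm => ?_
        rw [MvPolynomial.mem_support_iff, MvPolynomial.coeff_pderiv] at hm
        have h1 := MvPolynomial.le_totalDegree
          (MvPolynomial.mem_support_iff.2 (left_ne_zero_of_mul hm))
        rw [Finsupp.sum_add_index' (fun _ => rfl) (fun _ _ _ => rfl),
          Finsupp.sum_single_index rfl] at h1
        omega
      · have := toEnd_mulOp_x D i
        rw [h, zero_mul, mul_zero, zero_add] at this
        exact this.symm
    apply ih _ _ h
    have : D = MvPolynomial.C (D.coeff 0) := by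
      ext m
      rw [MvPolynomial.coeff_C]
      split_ifs with hm
      · rw [hm]
      · obtain ⟨i, hi⟩ : ∃ i, m i ≠ 0 := by
          by_contra! hc
          exact hm (Finsupp.ext fun i => (hc i).symm)
        have h1 := MvPolynomial.coeff_pderiv (i := i) D (m - Finsupp.single i 1)
        rw [hp i, MvPolynomial.coeff_zero, tsub_add_cancel_of_le (by
          rwa [Finsupp.single_le_iff, Nat.one_le_iff_ne_zero])] at h1
        refine (mul_eq_zero.1 h1.symm).resolve_right ?_
        exact Nat.cast_add_one_ne_zero _
    rw [this]
    simp

theorem toEnd_ne_zero {D : DiffOp n} (hD : D ≠ 0) : D.toEnd ≠ 0 :=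
  fun h => hD (toEnd_injective_aux _ D le_rfl h)

/-! ### Intertwining of the Airy Hamiltonians -/

/-- A differential operator in the differences `∂ᵢ - ∂ⱼ` commutes with `∑ᵢ xᵢ`. -/
theorem IsPolyInDifferences.sum_pderiv_eq_zero {D : DiffOp n} (hD : D.IsPolyInDifferences) :
    ∑ i, MvPolynomial.pderiv i D = 0 := by
  classical
  obtain ⟨P, rfl⟩ := hD
  induction P using MvPolynomial.induction_on with
  | C c => simp
  | add P Q hP hQ => simp only [MvPolynomial.eval₂_add, map_add, Finset.sum_add_distrib, hP, hQ,
      add_zero]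
  | mul_X P p hP =>
    simp only [MvPolynomial.eval₂_mul, MvPolynomial.eval₂_X, Derivation.leibniz,
      Finset.sum_add_distrib, ← Finset.smul_sum, hP, smul_zero, add_zero]
    simp [MvPolynomial.pderiv_X, Pi.single_apply]

theorem IsPolyInDifferences.commute {D : DiffOp n} (hD : D.IsPolyInDifferences) :
    D.toEnd * mulOp (∑ i, x i) = mulOp (∑ i, x i) * D.toEnd := by
  rw [mulOp_sum, Finset.mul_sum, Finset.sum_mul]
  simp only [toEnd_mulOp_x]
  rw [Finset.sum_add_distrib, ← toEnd_sum, hD.sum_pderiv_eq_zero, toEnd_zero, add_zero]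

theorem IsPolyInDifferences.intertwines_ham {D : DiffOp n} (hD : D.IsPolyInDifferences)
    (h : D.toEnd * Airy.lap n = Airy.lapTilde n * D.toEnd) :
    D.toEnd * Airy.ham n = Airy.hamTilde n * D.toEnd := by
  have h1 : Airy.ham n = Airy.lap n - mulOp (∑ i, x i) := by
    rw [Airy.ham, Airy.lap, mulOp_sum, Finset.sum_sub_distrib]
  have h2 : Airy.hamTilde n = Airy.lapTilde n - mulOp (∑ i, x i) := by
    rw [Airy.hamTilde, Airy.lapTilde, h1]
    abel
  rw [h2, h1, mul_sub, sub_mul, h, hD.commute]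

end DiffOp

/-! ### Polynomials in x and z -/

/-- Polynomials in `x₁, …, xₙ, z₁, …, zₙ`; `Sum.inl i` stands for `xᵢ` and `Sum.inr i` for
`zᵢ`. -/
abbrev Pol (n : ℕ) : Type := MvPolynomial (Fin n ⊕ Fin n) ℂ

/-- A linear change of variables carries the prime `X a` to `X a - X b`. -/
theorem MvPolynomial.prime_X_sub_X {τ : Type*} {a b : τ} (h : a ≠ b) :
    Prime (X a - X b : MvPolynomial τ ℂ) := by
  classical
  let f : MvPolynomial τ ℂ →ₐ[ℂ] MvPolynomial τ ℂ :=
    aeval fun k => if k = a then X a - X b else X k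
  let g : MvPolynomial τ ℂ →ₐ[ℂ] MvPolynomial τ ℂ :=
    aeval fun k => if k = a then X a + X b else X k
  have hfg : f.comp g = AlgHom.id ℂ _ := by
    ext1 k
    by_cases hk : k = a
    · subst hk; simp [f, g, h.symm]
    · simp [f, g, hk]
  have hgf : g.comp f = AlgHom.id ℂ _ := by
    ext1 k
    by_cases hk : k = a
    · subst hk; simp [f, g, h.symm]
    · simp [f, g, hk]
  have h1 : (AlgEquiv.ofAlgHom f g hfg hgf) (X a) = X a - X b := by simp [f]
  rw [← h1]
  exact (MulEquiv.prime_iff (AlgEquiv.ofAlgHom f g hfg hgf)).2 X_prime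

namespace Pol

variable {n : ℕ}

/-- The variable `xᵢ`. -/
def X (i : Fin n) : Pol n := MvPolynomial.X (Sum.inl i)

/-- The variable `zᵢ`. -/
def Z (i : Fin n) : Pol n := MvPolynomial.X (Sum.inr i)

/-- The derivation `∂/∂xᵢ`. -/
def dx (i : Fin n) : Derivation ℂ (Pol n) (Pol n) := MvPolynomial.pderiv (Sum.inl i)

/-- The derivation `∂/∂zᵢ`. -/
def dz (i : Fin n) : Derivation ℂ (Pol n) (Pol n) := MvPolynomial.pderiv (Sum.inr i)

@[simp] theorem dx_X (i j : Fin n) : dx i (X j) = if j = i then 1 else 0 := by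
  classical
  simp [dx, X, MvPolynomial.pderiv_X, Pi.single_apply]

@[simp] theorem dx_Z (i j : Fin n) : dx i (Z j) = 0 := by
  classical
  simp [dx, Z, MvPolynomial.pderiv_X]

@[simp] theorem dz_Z (i j : Fin n) : dz i (Z j) = if j = i then 1 else 0 := by
  classical
  simp [dz, Z, MvPolynomial.pderiv_X, Pi.single_apply]

@[simp] theorem dz_X (i j : Fin n) : dz i (X j) = 0 := by
  classical
  simp [dz, X, MvPolynomial.pderiv_X]

theorem dx_comm (i j : Fin n) (f : Pol n) : dx i (dx j f) = dx j (dx i f) :=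
  RatFun.pderiv_comm _ _ f

theorem dx_dz (i j : Fin n) (f : Pol n) : dx i (dz j f) = dz j (dx i f) :=
  RatFun.pderiv_comm _ _ f

theorem dx_mul (i : Fin n) (f g : Pol n) : dx i (f * g) = f * dx i g + g * dx i f :=
  (dx i).leibniz f g

theorem dz_mul (i : Fin n) (f g : Pol n) : dz i (f * g) = f * dz i g + g * dz i f :=
  (dz i).leibniz f g

/-- The operator `∂/∂xᵢ + zᵢ`, which is `∂/∂xᵢ` conjugated by `exp (∑ᵢ xᵢ zᵢ)`. -/
def D (i : Fin n) : Module.End ℂ (Pol n) :=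
  (dx i : Pol n →ₗ[ℂ] Pol n) + LinearMap.mulLeft ℂ (Z i)

theorem D_apply (i : Fin n) (f : Pol n) : D i f = dx i f + Z i * f := rfl

theorem D_mul (i : Fin n) (g f : Pol n) : D i (g * f) = g * D i f + dx i g * f := by
  rw [D_apply, D_apply, dx_mul]
  ring

theorem D_comm (i j : Fin n) (f : Pol n) : D i (D j f) = D j (D i f) := by
  simp only [D_apply, map_add, dx_mul, dx_Z, dx_comm i j]
  ring

/-! ### The Vandermonde product and its differential equation -/

/-- The Vandermonde product `∏_{i<j} (xᵢ - xⱼ)`. -/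
def vand : Pol n := ∏ p : OrdPair n, (X p.1.1 - X p.1.2)

/-- The Vandermonde product without the factor `xᵢ - xⱼ`. -/
def vandErase (i j : Fin n) : Pol n :=
  ∏ p ∈ Finset.univ.filter (fun p : OrdPair n => p.1 ≠ (i, j)), (X p.1.1 - X p.1.2)

/-- The quotient of the Vandermonde product by `xᵢ - xⱼ`, for arbitrary `i ≠ j`; it is `0` for
`i = j`. -/
def cofac (i j : Fin n) : Pol n :=
  if i < j then vandErase i j else if j < i then -vandErase j i else 0

theorem mul_vandErase {i j : Fin n} (h : i < j) : (X i - X j) * vandErase i j = vand := by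
  have h2 : (Finset.univ.filter fun p : OrdPair n => p.1 ≠ (i, j)) =
      Finset.univ.erase ⟨(i, j), h⟩ := by
    ext p
    simp [Subtype.ext_iff]
  have h3 := Finset.mul_prod_erase Finset.univ (fun p : OrdPair n => (X p.1.1 - X p.1.2 : Pol n))
    (Finset.mem_univ ⟨(i, j), h⟩)
  rw [vandErase, h2, vand, ← h3]

theorem mul_cofac {i j : Fin n} (h : i ≠ j) : (X i - X j) * cofac i j = vand := by
  rcases lt_or_gt_of_ne h with h | h
  · rw [cofac, if_pos h, mul_vandErase h]
  · rw [cofac, if_neg h.le.not_gt, if_pos h, ← mul_vandErase h]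
    ring

@[simp] theorem cofac_self (i : Fin n) : cofac i i = 0 := by simp [cofac]

theorem cofac_swap (i j : Fin n) : cofac j i = -cofac i j := by
  rcases lt_trichotomy i j with h | h | h
  · simp [cofac, h, h.le.not_gt]
  · simp [h]
  · simp [cofac, h, h.le.not_gt]

theorem sum_ordPair {M : Type*} [AddCommMonoid M] (F : Fin n → Fin n → M) :
    ∑ p : OrdPair n, F p.1.1 p.1.2 = ∑ i, ∑ j, if i < j then F i j else 0 := by
  classical
  rw [← Fintype.sum_prod_type' fun i j => if i < j then F i j else 0, ← Finset.sum_filter]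
  exact (Finset.sum_subtype (p := fun q : Fin n × Fin n => q.1 < q.2) _ (fun q => by simp)
    fun q => F q.1 q.2).symm

theorem sum_sum_of_symm {R : Type*} [CommRing R] (F : Fin n → Fin n → R) (hs : ∀ i j, F i j = F j i)
    (h0 : ∀ i, F i i = 0) : ∑ i, ∑ j, F i j = 2 * ∑ p : OrdPair n, F p.1.1 p.1.2 := by
  rw [sum_ordPair, two_mul]
  nth_rw 2 [Finset.sum_comm]
  rw [← Finset.sum_add_distrib]
  refine Finset.sum_congr rfl fun i _ => ?_
  rw [← Finset.sum_add_distrib]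
  refine Finset.sum_congr rfl fun j _ => ?_
  rcases lt_trichotomy i j with h | h | h
  · simp [h, h.le.not_gt]
  · simp [h, h0]
  · simp [h, h.le.not_gt, hs i j]

theorem derivation_prod {ι : Type*} [DecidableEq ι] (d : Derivation ℂ (Pol n) (Pol n))
    (s : Finset ι) (f : ι → Pol n) :
    d (∏ i ∈ s, f i) = ∑ i ∈ s, (∏ j ∈ s.erase i, f j) * d (f i) := by
  induction s using Finset.induction_on with
  | empty => simp
  | insert a s ha ih =>
    rw [Finset.prod_insert ha, d.leibniz, ih, Finset.sum_insert ha, Finset.erase_insert ha, add_comm,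
      smul_eq_mul, smul_eq_mul, Finset.mul_sum]
    congr 1
    refine Finset.sum_congr rfl fun i hi => ?_
    rw [Finset.erase_insert_of_ne (by rintro rfl; exact ha hi),
      Finset.prod_insert (fun h => ha (Finset.mem_of_mem_erase h)), mul_assoc]

theorem derivation_vand (d : Derivation ℂ (Pol n) (Pol n)) :
    d vand = ∑ p : OrdPair n, vandErase p.1.1 p.1.2 * (d (X p.1.1) - d (X p.1.2)) := by
  classical
  rw [vand, derivation_prod]
  refine Finset.sum_congr rfl fun p _ => ?_
  rw [map_sub, vandErase]
  congr 2
  ext q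
  simp [Subtype.ext_iff]

theorem dx_vand (i : Fin n) : dx i vand = ∑ j, cofac i j := by
  rw [derivation_vand, sum_ordPair fun k l => vandErase k l * (dx i (X k) - dx i (X l))]
  simp only [dx_X, mul_sub, mul_ite, mul_one, mul_zero]
  have h : ∀ k l : Fin n, (if k < l then (if k = i then vandErase k l else 0) -
      (if l = i then vandErase k l else 0) else 0) =
      (if k = i then (if k < l then vandErase k l else 0) else 0) -
        (if l = i then (if k < l then vandErase k l else 0) else 0) := by
    intro k l
    split_ifs <;> simp
  simp only [h, Finset.sum_sub_distrib]
  rw [Finset.sum_comm]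
  simp only [Finset.sum_ite_eq', Finset.mem_univ, if_true]
  rw [← Finset.sum_sub_distrib]
  refine Finset.sum_congr rfl fun j _ => ?_
  rw [cofac]
  rcases lt_trichotomy i j with h | h | h
  · simp [h, h.le.not_gt]
  · simp [h]
  · simp [h, h.le.not_gt]

theorem X_sub_ne_zero {i j : Fin n} (h : i ≠ j) : (X i - X j : Pol n) ≠ 0 :=
  (MvPolynomial.prime_X_sub_X (Sum.inl_injective.ne h)).ne_zero

theorem prime_X_sub {i j : Fin n} (h : i ≠ j) : Prime (X i - X j : Pol n) :=
  MvPolynomial.prime_X_sub_X (Sum.inl_injective.ne h)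

theorem vand_ne_zero : (vand : Pol n) ≠ 0 :=
  Finset.prod_ne_zero_iff.2 fun p _ => X_sub_ne_zero p.2.ne

/-- This is `1/((xᵢ-xⱼ)(xᵢ-xₖ))` plus its cyclic shifts equal to zero, multiplied by `A²`. -/
theorem cofac_three {i j k : Fin n} (hij : i ≠ j) (hjk : j ≠ k) (hki : k ≠ i) :
    cofac i j * cofac i k + cofac j k * cofac j i + cofac k i * cofac k j = 0 := by
  have h1 := mul_cofac hij
  have h2 := mul_cofac hjk
  have h3 := mul_cofac hki
  rw [cofac_swap k i, cofac_swap i j, cofac_swap j k]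
  refine (mul_eq_zero.1 (?_ : (X i - X j) * (X j - X k) * (X k - X i) * _ = 0)).resolve_left
    (mul_ne_zero (mul_ne_zero (X_sub_ne_zero hij) (X_sub_ne_zero hjk)) (X_sub_ne_zero hki))
  have e : (X i - X j) * (X j - X k) * (X k - X i) *
      (cofac i j * -cofac k i + cofac j k * -cofac i j + cofac k i * -cofac j k) =
      -((X j - X k) * (((X i - X j) * cofac i j) * ((X k - X i) * cofac k i)) +
        (X k - X i) * (((X i - X j) * cofac i j) * ((X j - X k) * cofac j k)) +
        (X i - X j) * (((X j - X k) * cofac j k) * ((X k - X i) * cofac k i))) := by ring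
  rw [e, h1, h2, h3]
  ring

/-- The sum of the cross terms of `|∇A|²` cancels. -/
theorem sum_sq_dx_vand :
    ∑ i, (dx i vand : Pol n) ^ 2 = ∑ i, ∑ j, cofac (n := n) i j ^ 2 := by
  classical
  -- Only `j = k` has to be excluded by hand: `cofac i i = 0` makes the other degenerate terms
  -- vanish.
  let c (i j k : Fin n) : Pol n := if j = k then 0 else cofac i j * cofac i k
  have hc : ∀ i j k, c i j k + c j k i + c k i j = 0 := by
    intro i j k
    by_cases hij : i = j
    · subst hij; by_cases hk : i = k
      · subst hk; simp [c]
      · simp [c]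
    by_cases hjk : j = k
    · subst hjk; simp [c]
    by_cases hki : k = i
    · subst hki; simp [c]
    simp only [c, if_neg hij, if_neg hjk, if_neg hki]
    exact cofac_three hij hjk hki
  have h3 : ∑ i, ∑ j, ∑ k, c i j k = 0 := by
    have r1 : ∑ i, ∑ j, ∑ k, c j k i = ∑ i, ∑ j, ∑ k, c i j k := by
      rw [Finset.sum_comm]
      exact Finset.sum_congr rfl fun i _ => Finset.sum_comm
    have r2 : ∑ i, ∑ j, ∑ k, c k i j = ∑ i, ∑ j, ∑ k, c i j k := by
      rw [← r1]
      rw [Finset.sum_congr rfl fun i _ => Finset.sum_comm, Finset.sum_comm]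
      exact r1.symm
    have h : ∑ i, ∑ j, ∑ k, (c i j k + c j k i + c k i j) = 0 := by simp [hc]
    simp only [Finset.sum_add_distrib] at h
    rw [r1, r2] at h
    have h' : (3 : Pol n) * ∑ i, ∑ j, ∑ k, c i j k = 0 := by linear_combination h
    exact (mul_eq_zero.1 h').resolve_left (by norm_num)
  have h4 : ∀ i, (dx i vand : Pol n) ^ 2 = ∑ j, cofac i j ^ 2 + ∑ j, ∑ k, c i j k := by
    intro i
    rw [dx_vand, sq, Finset.sum_mul_sum, ← Finset.sum_add_distrib]
    refine Finset.sum_congr rfl fun j _ => ?_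
    have : ∀ k, cofac i j * cofac i k = (if j = k then cofac i j ^ 2 else 0) + c i j k := by
      intro k
      simp only [c]
      split_ifs with h
      · rw [h]; ring
      · ring
    simp only [this, Finset.sum_add_distrib, Finset.sum_ite_eq, Finset.mem_univ, if_true]
  rw [Finset.sum_congr rfl fun i _ => h4 i, Finset.sum_add_distrib, h3, add_zero]

/-- The differential equation of the Vandermonde product: `Δ̃ (A⁻¹) = 0`, cleared of
denominators. -/
theorem vand_identity :
    (vand : Pol n) * ∑ i, dx i (dx i vand) - 2 * ∑ i, dx i vand ^ 2 =
      -4 * ∑ p : OrdPair n, vandErase p.1.1 p.1.2 ^ 2 := by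
  have h1 : ∀ i j : Fin n, vand * dx i (cofac i j) = cofac i j * (dx i vand - cofac i j) := by
    intro i j
    by_cases h : i = j
    · subst h; simp
    have h2 := congrArg (dx i) (mul_cofac h)
    rw [dx_mul, map_sub, dx_X, dx_X, if_pos rfl, if_neg (Ne.symm h)] at h2
    rw [← h2, ← mul_cofac h]
    ring
  have h2 : ∀ i : Fin n, vand * dx i (dx i vand) = dx i vand ^ 2 - ∑ j, cofac i j ^ 2 := by
    intro i
    have h3 : dx i (dx i vand) = ∑ j, dx i (cofac i j) :=
      (congrArg (dx i) (dx_vand i)).trans (map_sum _ _ _)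
    rw [h3, Finset.mul_sum, Finset.sum_congr rfl fun j _ => h1 i j]
    simp only [mul_sub, Finset.sum_sub_distrib]
    rw [← Finset.sum_mul, ← dx_vand, sq]
    simp only [sq]
  rw [Finset.mul_sum, Finset.sum_congr rfl fun i _ => h2 i, Finset.sum_sub_distrib,
    sum_sq_dx_vand,
    sum_sum_of_symm (fun i j => cofac (n := n) i j ^ 2) (fun i j => by rw [cofac_swap j i]; ring)
      (fun i => by simp)]
  have : ∀ p : OrdPair n, cofac p.1.1 p.1.2 = vandErase p.1.1 p.1.2 := fun p => by
    rw [cofac, if_pos p.2]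
  simp only [this]
  ring

/-! ### Non-divisibility by the linear factors -/

theorem not_dvd_of_eval {f g : Pol n} (v : Fin n ⊕ Fin n → ℂ) (hf : MvPolynomial.eval v f = 0)
    (hg : MvPolynomial.eval v g ≠ 0) : ¬f ∣ g := by
  rintro ⟨h, rfl⟩
  rw [map_mul, hf, zero_mul] at hg
  exact hg rfl

/-- A point of the hyperplane `xᵢ = xⱼ` and of no other hyperplane. -/
def hyperplanePoint (i j : Fin n) : Fin n ⊕ Fin n → ℂ :=
  -- The `+ 1` keeps the index `0` away from the value `0` taken at `i` and `j`; the `z`-coordinates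
  -- are all distinct.
  Sum.elim (fun k => if k = i ∨ k = j then 0 else (k : ℂ) + 1) fun k => (k : ℂ)

theorem eval_hyperplanePoint (i j : Fin n) :
    MvPolynomial.eval (hyperplanePoint i j) (X i - X j) = 0 := by
  simp [hyperplanePoint, X]

theorem Z_sub_not_dvd {i j k l : Fin n} (h : k ≠ l) : ¬(X i - X j : Pol n) ∣ Z k - Z l := by
  refine not_dvd_of_eval _ (eval_hyperplanePoint i j) ?_
  simp only [map_sub, Z, MvPolynomial.eval_X, hyperplanePoint, Sum.elim_inr]
  rw [sub_ne_zero]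
  exact_mod_cast fun e => h (Fin.ext e)

theorem X_sub_not_dvd {i j k l : Fin n} (h : k ≠ l) (h1 : ¬(k = i ∧ l = j))
    (h2 : ¬(k = j ∧ l = i)) : ¬(X i - X j : Pol n) ∣ X k - X l := by
  refine not_dvd_of_eval _ (eval_hyperplanePoint i j) ?_
  simp only [map_sub, X, MvPolynomial.eval_X, hyperplanePoint, Sum.elim_inl]
  rw [sub_ne_zero]
  split_ifs with hk hl hl
  · exfalso
    rcases hk with rfl | rfl <;> rcases hl with rfl | rfl <;> simp_all
  · exact (Nat.cast_add_one_ne_zero _).symm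
  · exact Nat.cast_add_one_ne_zero _
  · intro e
    have e' : ((k : ℕ) : ℂ) = ((l : ℕ) : ℂ) := add_right_cancel e
    exact h (Fin.ext (by exact_mod_cast e'))

/-! ### The conjugated operator and quasi-invariants -/

/-- The operator `A (∑ᵢ ∂ᵢ²) - 2 ∑ᵢ (∂ᵢ A) ∂ᵢ`, where `A` is the Vandermonde product, conjugated by
`exp (∑ᵢ xᵢ zᵢ)`. -/
def opA : Module.End ℂ (Pol n) :=
  LinearMap.mulLeft ℂ vand * ∑ i, D i * D i - (2 : ℂ) • ∑ i, LinearMap.mulLeft ℂ (dx i vand) * D i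

/-- The operator `opA` minus its eigenvalue `A ∑ᵢ zᵢ²`. -/
def opM : Module.End ℂ (Pol n) := opA - LinearMap.mulLeft ℂ (vand * ∑ i, Z i ^ 2)

theorem opA_apply (f : Pol n) :
    opA f = vand * ∑ i, D i (D i f) - 2 * ∑ i, dx i vand * D i f := by
  rw [opA, LinearMap.sub_apply, Module.End.mul_apply, LinearMap.smul_apply, LinearMap.sum_apply,
    LinearMap.sum_apply, LinearMap.mulLeft_apply, MvPolynomial.smul_eq_C_mul]
  rfl

theorem opM_apply (f : Pol n) : opM f = opA f - vand * (∑ i, Z i ^ 2) * f := rfl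

/-- The sum over all pairs of the numerators of `(∂ᵢ - ∂ⱼ) f / (xᵢ - xⱼ)`. -/
theorem sum_cofac_mul (g : Fin n → Pol n) :
    ∑ i, ∑ j, cofac i j * (g i - g j) = 2 * ∑ i, dx i vand * g i := by
  have h : ∀ i, dx i vand * g i = ∑ j, cofac i j * g i := fun i => by rw [dx_vand, Finset.sum_mul]
  simp only [mul_sub, Finset.sum_sub_distrib, h]
  have h2 : ∑ i, ∑ j, cofac i j * g j = -∑ i, ∑ j, cofac i j * g i := by
    rw [Finset.sum_comm]
    simp only [← Finset.sum_neg_distrib]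
    exact Finset.sum_congr rfl fun i _ => Finset.sum_congr rfl fun j _ => by
      rw [cofac_swap i j, neg_mul]
  rw [h2]
  ring

theorem sum_eq_add_add {R : Type*} [AddCommMonoid R] {i j : Fin n} (h : i ≠ j) (F : Fin n → R) :
    ∑ k, F k = F i + F j + ∑ k ∈ Finset.univ.filter (fun k => k ≠ i ∧ k ≠ j), F k := by
  have : (Finset.univ : Finset (Fin n)) =
      insert i (insert j (Finset.univ.filter fun k => k ≠ i ∧ k ≠ j)) := by
    ext k
    simp
    tauto
  nth_rw 1 [this]
  rw [Finset.sum_insert (by simp [h]), Finset.sum_insert (by simp), add_assoc]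

/-- Modulo `x`, pairs disjoint from `{i, j}` drop out singly, pairs meeting it in one index cancel
two by two, and only `(i, j)` and `(j, i)` survive. -/
theorem dvd_sum_sum {R : Type*} [CommRing R] {i j : Fin n} (h : i ≠ j) (x : R)
    (H : Fin n → Fin n → R) (hs : ∀ k l, H k l = H l k) (h0 : ∀ k, H k k = 0)
    (h1 : ∀ k, k ≠ i → k ≠ j → x ∣ H i k + H j k)
    (h2 : ∀ k l, k ≠ i → k ≠ j → l ≠ i → l ≠ j → x ∣ H k l) :
    x ∣ ∑ k, ∑ l, H k l - 2 * H i j := by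
  rw [sum_eq_add_add h]
  have e1 : ∑ l, H i l + ∑ l, H j l = 2 * H i j +
      ∑ k ∈ Finset.univ.filter (fun k => k ≠ i ∧ k ≠ j), (H i k + H j k) := by
    rw [← Finset.sum_add_distrib, sum_eq_add_add h, h0, h0, hs j i]
    ring
  rw [e1, add_assoc, add_sub_cancel_left]
  refine dvd_add (Finset.dvd_sum fun k hk => ?_) (Finset.dvd_sum fun k hk => ?_)
  · simp only [Finset.mem_filter, Finset.mem_univ, true_and] at hk
    exact h1 k hk.1 hk.2
  · simp only [Finset.mem_filter, Finset.mem_univ, true_and] at hk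
    rw [sum_eq_add_add h, hs k i, hs k j]
    refine dvd_add (h1 k hk.1 hk.2) (Finset.dvd_sum fun l hl => ?_)
    simp only [Finset.mem_filter, Finset.mem_univ, true_and] at hl
    exact h2 k l hk.1 hk.2 hl.1 hl.2

/-- `f exp (∑ᵢ xᵢ zᵢ)` is quasi-invariant: its derivative `∂ᵢ - ∂ⱼ` vanishes for `xᵢ = xⱼ`. -/
def IsQuasiInvariant (f : Pol n) : Prop := ∀ i j, i ≠ j → (X i - X j) ∣ D i f - D j f

theorem isQuasiInvariant_vand_sq : IsQuasiInvariant (vand ^ 2 : Pol n) := by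
  intro i j h
  refine dvd_trans ⟨cofac i j, (mul_cofac h).symm⟩
    ⟨2 * dx i vand + Z i * vand - 2 * dx j vand - Z j * vand, ?_⟩
  simp only [D_apply, sq, dx_mul]
  ring

/-- With `G k l = (Dₖ - Dₗ) f / (xₖ - xₗ)` the quotient `opM f / A` is visibly polynomial. It is
again quasi-invariant because, modulo `xᵢ - xⱼ`, applying `Dᵢ - Dⱼ` to `∑ Dₖ² f` and to `∑ G k l`
leaves the same term `2 (Dᵢ - Dⱼ) (G i j)`. -/
theorem IsQuasiInvariant.exists_step {f : Pol n} (hf : IsQuasiInvariant f) :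
    ∃ f' : Pol n, vand * f' = opM f ∧ IsQuasiInvariant f' := by
  have hG : ∀ k l, ∃ g, D k f - D l f = (X k - X l) * g ∧ (k = l → g = 0) := by
    intro k l
    by_cases h : k = l
    · exact ⟨0, by simp [h], fun _ => rfl⟩
    · obtain ⟨g, hg⟩ := hf k l h
      exact ⟨g, hg, fun h' => absurd h' h⟩
  choose G hG hG0 using hG
  have hGs : ∀ k l, G k l = G l k := by
    intro k l
    by_cases h : k = l
    · rw [h]
    · apply mul_left_cancel₀ (X_sub_ne_zero h)
      linear_combination (-1 : Pol n) * hG k l - hG l k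
  -- The sum over ordered pairs counts each pair twice and so absorbs the factor `2` of `opA`.
  refine ⟨∑ k, (D k (D k f) - Z k ^ 2 * f) - ∑ k, ∑ l, G k l, ?_, ?_⟩
  · have h : ∑ k, ∑ l, vand * G k l = 2 * ∑ k, dx k vand * D k f := by
      rw [← sum_cofac_mul]
      refine Finset.sum_congr rfl fun k _ => Finset.sum_congr rfl fun l _ => ?_
      by_cases hkl : k = l
      · rw [hG0 k l hkl, hkl, cofac_self]; ring
      · rw [hG, ← mul_cofac hkl]; ring
    have h' : ∑ k, ∑ l, vand * G k l = vand * ∑ k, ∑ l, G k l := by simp only [Finset.mul_sum]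
    rw [opM_apply, opA_apply, ← h, h', Finset.sum_sub_distrib, ← Finset.sum_mul]
    ring
  · intro i j hij
    have hp := prime_X_sub hij
    have hH : ∀ k l, (X k - X l) * (D i (G k l) - D j (G k l)) +
        (dx i (X k - X l) - dx j (X k - X l)) * G k l =
        (X i - X j) * (D k (G i j) - D l (G i j)) +
        (dx k (X i - X j) - dx l (X i - X j)) * G i j := by
      intro k l
      have e1 : D i (D k f - D l f) - D j (D k f - D l f) =
          D k (D i f - D j f) - D l (D i f - D j f) := by
        simp only [map_sub, D_comm i, D_comm j]
        ring
      rw [hG, hG, D_mul, D_mul, D_mul, D_mul] at e1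
      linear_combination e1
    have hsum : (X i - X j) ∣ ∑ k, ∑ l, (D i (G k l) - D j (G k l)) -
        2 * (D i (G i j) - D j (G i j)) := by
      refine dvd_sum_sum hij _ (fun k l => D i (G k l) - D j (G k l))
        (fun k l => by rw [hGs k l]) (fun k => by rw [hG0 k k rfl]; simp) ?_ ?_
      · intro k hki hkj
        have e1 := hH i k
        have e2 := hH j k
        have hq := X_sub_not_dvd (i := i) (j := j) hkj.symm (fun h => hij h.1.symm)
          (fun h => hki h.2)
        simp only [map_sub, dx_X, if_true, if_neg hij, if_neg hij.symm, if_neg hki, if_neg hkj,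
          if_neg hki.symm, if_neg hkj.symm] at e1 e2
        have e3 := hG i k
        have e4 := hG j k
        have e5 := hG i j
        -- The first factor `xⱼ - xₖ` brings in the two commutation relations, which leave `G i k -
        -- G j k`; the second makes this difference a multiple of `xᵢ - xⱼ`. Both are then
        -- cancelled, `xᵢ - xⱼ` being prime.
        have hd : (X i - X j) ∣ (X j - X k) * ((X j - X k) *
            (D i (G i k) - D j (G i k) + (D i (G j k) - D j (G j k)))) := by
          refine ⟨(X j - X k) * (D i (G i j) - D k (G i j) + D j (G i j) - D k (G i j)) -
            G i j + G i k - (X j - X k) * (D i (G i k) - D j (G i k)), ?_⟩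
          linear_combination (X j - X k) * e1 + (X j - X k) * e2 + e3 - e4 - e5
        exact (hp.dvd_or_dvd ((hp.dvd_or_dvd hd).resolve_left hq)).resolve_left hq
      · intro k l hki hkj hli hlj
        by_cases hkl : k = l
        · rw [hG0 k l hkl]; simp
        have e1 := hH k l
        simp only [map_sub, dx_X, if_neg hki, if_neg hkj, if_neg hli, if_neg hlj, if_neg hki.symm,
          if_neg hkj.symm, if_neg hli.symm, if_neg hlj.symm] at e1
        have hq := X_sub_not_dvd (i := i) (j := j) hkl (fun h => hki h.1) (fun h => hkj h.1)
        refine (hp.dvd_or_dvd (⟨D k (G i j) - D l (G i j), ?_⟩ :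
          (X i - X j) ∣ (X k - X l) * _)).resolve_left hq
        linear_combination e1
    obtain ⟨S, hS⟩ := hsum
    have hk : ∀ k, D i (D k (D k f)) - D j (D k (D k f)) =
        (X i - X j) * D k (D k (G i j)) + 2 * dx k (X i - X j) * D k (G i j) := by
      intro k
      have e1 : D i (D k (D k f)) - D j (D k (D k f)) = D k (D k (D i f - D j f)) := by
        simp only [map_sub]
        rw [D_comm i k, D_comm i k, D_comm j k, D_comm j k]
      rw [e1, hG, D_mul, map_add, D_mul, D_mul]
      have : dx k (dx k (X i - X j)) = 0 := by
        simp only [map_sub, dx_X, apply_ite (dx k)]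
        simp
      rw [this]
      ring
    have hz : ∀ k, D i (Z k ^ 2 * f) - D j (Z k ^ 2 * f) = Z k ^ 2 * ((X i - X j) * G i j) := by
      intro k
      rw [D_mul, D_mul, ← hG, sq, dx_mul, dx_mul, dx_Z, dx_Z]
      ring
    -- Twice this is the cross term of `∑ Dₖ²` applied to `(xᵢ - xⱼ) G i j`, and it cancels the
    -- surviving term of the double sum.
    have ht : ∑ k, dx k (X i - X j) * D k (G i j) = D i (G i j) - D j (G i j) := by
      simp only [map_sub, dx_X, sub_mul, ite_mul, one_mul, zero_mul, Finset.sum_sub_distrib,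
        Finset.sum_ite_eq, Finset.mem_univ, if_true]
    refine ⟨∑ k, (D k (D k (G i j)) - Z k ^ 2 * G i j) - S, ?_⟩
    have e : ∀ a : Fin n, D a (∑ k, (D k (D k f) - Z k ^ 2 * f) - ∑ k, ∑ l, G k l) =
        ∑ k, (D a (D k (D k f)) - D a (Z k ^ 2 * f)) - ∑ k, ∑ l, D a (G k l) := by
      intro a
      simp only [map_sub, map_sum]
    have e2 : ∑ k, (D i (D k (D k f)) - D i (Z k ^ 2 * f)) -
        ∑ k, (D j (D k (D k f)) - D j (Z k ^ 2 * f)) =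
        (X i - X j) * ∑ k, (D k (D k (G i j)) - Z k ^ 2 * G i j) +
          2 * ∑ k, dx k (X i - X j) * D k (G i j) := by
      rw [← Finset.sum_sub_distrib, Finset.mul_sum, Finset.mul_sum, ← Finset.sum_add_distrib]
      refine Finset.sum_congr rfl fun k _ => ?_
      linear_combination hk k - hz k
    simp only [Finset.sum_sub_distrib] at hS
    rw [e, e]
    linear_combination e2 - hS + 2 * ht

/-! ### Grading and filtration by the degree in x -/

/-- The derivation `∑ᵢ zᵢ ∂/∂xᵢ`. -/
def zdx : Derivation ℂ (Pol n) (Pol n) := ∑ i, Z i • dx i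

/-- The Euler derivation `∑ᵢ xᵢ ∂/∂xᵢ`. -/
def euler : Derivation ℂ (Pol n) (Pol n) := ∑ i, X i • dx i

theorem derivation_sum_apply {ι : Type*} (s : Finset ι) (d : ι → Derivation ℂ (Pol n) (Pol n))
    (f : Pol n) : (∑ i ∈ s, d i) f = ∑ i ∈ s, d i f := by
  classical
  induction s using Finset.induction_on with
  | empty => simp
  | insert a s ha ih => rw [Finset.sum_insert ha, Finset.sum_insert ha, Derivation.add_apply, ih]

theorem zdx_apply (f : Pol n) : zdx f = ∑ i, Z i * dx i f := by
  rw [zdx, derivation_sum_apply]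
  rfl

theorem euler_apply (f : Pol n) : euler f = ∑ i, X i * dx i f := by
  rw [euler, derivation_sum_apply]
  rfl

theorem zdx_mul (f g : Pol n) : zdx (f * g) = f * zdx g + g * zdx f := zdx.leibniz f g

@[simp] theorem zdx_X (i : Fin n) : zdx (X i) = Z i := by simp [zdx_apply]

@[simp] theorem zdx_Z (i : Fin n) : zdx (Z i) = 0 := by simp [zdx_apply]

@[simp] theorem euler_X (i : Fin n) : euler (X i) = X i := by simp [euler_apply]

@[simp] theorem euler_Z (i : Fin n) : euler (Z i) = 0 := by simp [euler_apply]

/-- The degree of a monomial in the `x`-variables. -/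
def xdeg (m : Fin n ⊕ Fin n →₀ ℕ) : ℤ := ∑ i, (m (Sum.inl i) : ℤ)

theorem xdeg_nonneg (m : Fin n ⊕ Fin n →₀ ℕ) : 0 ≤ xdeg m :=
  Finset.sum_nonneg fun _ _ => Int.natCast_nonneg _

theorem euler_monomial (m : Fin n ⊕ Fin n →₀ ℕ) (c : ℂ) :
    euler (MvPolynomial.monomial m c) = (xdeg m : ℂ) • MvPolynomial.monomial m c := by
  rw [euler_apply, xdeg, Int.cast_sum, Finset.sum_smul]
  refine Finset.sum_congr rfl fun i _ => ?_
  rw [X, dx, MvPolynomial.X_mul_pderiv_monomial, Int.cast_natCast, Nat.cast_smul_eq_nsmul]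

theorem coeff_euler (m : Fin n ⊕ Fin n →₀ ℕ) (f : Pol n) :
    (euler f).coeff m = (xdeg m : ℂ) * f.coeff m := by
  classical
  induction f using MvPolynomial.induction_on' with
  | monomial a c =>
    rw [euler_monomial, MvPolynomial.coeff_smul, MvPolynomial.coeff_monomial, smul_eq_mul]
    split_ifs with h
    · rw [h]
    · simp
  | add f g hf hg => rw [map_add, MvPolynomial.coeff_add, MvPolynomial.coeff_add, hf, hg, mul_add]

/-- The eigenspace of a derivation for the eigenvalue `k`. -/
def eigen (d : Derivation ℂ (Pol n) (Pol n)) (k : ℤ) : Submodule ℂ (Pol n) where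
  carrier := {f | d f = (k : ℂ) • f}
  add_mem' {f g} hf hg := by
    simp only [Set.mem_ofPred_eq] at *
    rw [map_add, hf, hg, smul_add]
  zero_mem' := by simp
  smul_mem' c f hf := by
    simp only [Set.mem_ofPred_eq] at *
    rw [Derivation.map_smul, hf, smul_comm]

theorem mem_eigen {d : Derivation ℂ (Pol n) (Pol n)} {k : ℤ} {f : Pol n} :
    f ∈ eigen d k ↔ d f = (k : ℂ) • f := Iff.rfl

theorem mul_mem_eigen {d : Derivation ℂ (Pol n) (Pol n)} {a b : ℤ} {f g : Pol n}
    (hf : f ∈ eigen d a) (hg : g ∈ eigen d b) : f * g ∈ eigen d (a + b) := by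
  rw [mem_eigen] at *
  rw [d.leibniz, hf, hg]
  push_cast
  simp only [MvPolynomial.smul_eq_C_mul, map_add, smul_eq_mul]
  ring

theorem mem_eigen_of_mul {d : Derivation ℂ (Pol n) (Pol n)} {a k : ℤ} {f g : Pol n} (h0 : f ≠ 0)
    (hf : f ∈ eigen d a) (h : f * g ∈ eigen d k) : g ∈ eigen d (k - a) := by
  rw [mem_eigen] at *
  rw [d.leibniz, hf] at h
  apply mul_left_cancel₀ h0
  simp only [MvPolynomial.smul_eq_C_mul, Int.cast_sub, map_sub, smul_eq_mul] at *
  linear_combination h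

theorem natCast_mem_eigen (d : Derivation ℂ (Pol n) (Pol n)) (c : ℕ) :
    (c : Pol n) ∈ eigen d 0 := by simp [mem_eigen]

/-- The polynomials that are homogeneous of degree `k` in `x`. -/
abbrev homog (k : ℤ) : Submodule ℂ (Pol n) := eigen euler k

theorem mem_homog {k : ℤ} {f : Pol n} : f ∈ homog k ↔ euler f = (k : ℂ) • f := Iff.rfl

theorem xdeg_eq_of_mem_homog {k : ℤ} {f : Pol n} (hf : f ∈ homog k) {m : Fin n ⊕ Fin n →₀ ℕ}
    (hm : f.coeff m ≠ 0) : xdeg m = k := by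
  have h := coeff_euler m f
  rw [mem_homog.1 hf, MvPolynomial.coeff_smul, smul_eq_mul] at h
  exact_mod_cast (mul_right_cancel₀ hm h).symm

theorem eq_zero_of_mem_homog_neg {k : ℤ} {f : Pol n} (hf : f ∈ homog k) (hk : k < 0) : f = 0 := by
  ext m
  by_contra hm
  have := xdeg_eq_of_mem_homog hf hm
  have := xdeg_nonneg m
  omega

theorem X_mem (i : Fin n) : (X i : Pol n) ∈ homog 1 := by simp [mem_homog]

theorem Z_mem (i : Fin n) : (Z i : Pol n) ∈ homog 0 := by simp [mem_homog]

theorem dx_mem {k : ℤ} {f : Pol n} (hf : f ∈ homog k) (i : Fin n) : dx i f ∈ homog (k - 1) := by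
  rw [mem_homog] at *
  have h := congrArg (dx i) hf
  rw [euler_apply, map_sum] at h
  simp only [dx_mul, dx_X, Finset.sum_add_distrib, mul_ite, mul_one, mul_zero,
    Finset.sum_ite_eq', Finset.mem_univ, if_true, dx_comm i, Derivation.map_smul] at h
  rw [← euler_apply] at h
  push_cast
  rw [sub_smul, ← h, one_smul, add_sub_cancel_right]

theorem dz_mem {k : ℤ} {f : Pol n} (hf : f ∈ homog k) (i : Fin n) : dz i f ∈ homog k := by
  rw [mem_homog] at *
  rw [← Derivation.map_smul, ← hf, euler_apply, euler_apply, map_sum]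
  simp only [dz_mul, dz_X, dx_dz, mul_zero, add_zero]

/-- The polynomials of degree less than `d` in `x`. -/
def degLT (d : ℤ) : Submodule ℂ (Pol n) where
  carrier := {f | ∀ m, f.coeff m ≠ 0 → xdeg m < d}
  add_mem' {f g} hf hg m hm := by
    by_cases h : f.coeff m = 0
    · exact hg m (by rwa [MvPolynomial.coeff_add, h, zero_add] at hm)
    · exact hf m h
  zero_mem' m hm := by simp at hm
  smul_mem' c f hf m hm := hf m fun h => hm (by rw [MvPolynomial.coeff_smul, h, smul_zero])

theorem degLT_mono {d e : ℤ} (h : d ≤ e) {f : Pol n} (hf : f ∈ degLT d) : f ∈ degLT e :=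
  fun m hm => (hf m hm).trans_le h

theorem mem_degLT_of_mem_homog {k d : ℤ} {f : Pol n} (hf : f ∈ homog k) (h : k < d) :
    f ∈ degLT d := fun m hm => by rwa [xdeg_eq_of_mem_homog hf hm]

theorem eq_zero_of_mem_degLT {d : ℤ} {f : Pol n} (hf : f ∈ degLT d) (h : d ≤ 0) : f = 0 := by
  ext m
  by_contra hm
  have := hf m hm
  have := xdeg_nonneg m
  omega

theorem eq_zero_of_mem {k : ℤ} {f : Pol n} (hf : f ∈ homog k) (hf' : f ∈ degLT k) : f = 0 := by
  ext m
  by_contra hm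
  have h1 := hf' m hm
  have h2 := xdeg_eq_of_mem_homog hf hm
  omega

theorem monomial_mem (m : Fin n ⊕ Fin n →₀ ℕ) (c : ℂ) :
    (MvPolynomial.monomial m c : Pol n) ∈ homog (xdeg m) := euler_monomial m c

theorem degLT_induction {d : ℤ} {p : Pol n → Prop} (h0 : p 0)
    (hadd : ∀ f g, p f → p g → p (f + g)) (h : ∀ k < d, ∀ f ∈ homog k, p f) {f : Pol n}
    (hf : f ∈ degLT d) : p f := by
  rw [f.as_sum]
  refine Finset.sum_induction _ p (fun a b => hadd a b) h0 fun m hm => ?_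
  exact h _ (hf m (MvPolynomial.mem_support_iff.1 hm)) _ (monomial_mem m _)

theorem map_mem_degLT (T : Module.End ℂ (Pol n)) {s : ℤ}
    (hT : ∀ k, ∀ f ∈ homog k, T f ∈ homog (k + s)) {d : ℤ} {f : Pol n} (hf : f ∈ degLT d) :
    T f ∈ degLT (d + s) := by
  refine degLT_induction (p := fun f => T f ∈ degLT (d + s)) (by simp)
    (fun f g hf hg => by rw [map_add]; exact add_mem hf hg) (fun k hk f hf => ?_) hf
  exact mem_degLT_of_mem_homog (hT k f hf) (by omega)

theorem exists_homog_add {d : ℤ} {f : Pol n} (hf : f ∈ degLT (d + 1)) :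
    ∃ q ∈ homog d, ∃ r ∈ degLT d, f = q + r := by
  refine degLT_induction (p := fun f => ∃ q ∈ homog d, ∃ r ∈ degLT d, f = q + r)
    ⟨0, zero_mem _, 0, zero_mem _, by simp⟩ ?_ (fun k hk g hg => ?_) hf
  · rintro _ _ ⟨q, hq, r, hr, rfl⟩ ⟨q', hq', r', hr', rfl⟩
    exact ⟨q + q', add_mem hq hq', r + r', add_mem hr hr', by ring⟩
  · rcases (Int.lt_add_one_iff.1 hk).lt_or_eq with h | rfl
    · exact ⟨0, zero_mem _, g, mem_degLT_of_mem_homog hg h, by simp⟩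
    · exact ⟨g, hg, 0, zero_mem _, by simp⟩

theorem mul_mem_degLT {a d : ℤ} {f g : Pol n} (hf : f ∈ homog a) (hg : g ∈ degLT d) :
    f * g ∈ degLT (d + a) :=
  map_mem_degLT (LinearMap.mulLeft ℂ f) (fun k h hh => by
    rw [add_comm]; exact mul_mem_eigen hf hh) hg

theorem exists_mem_degLT (d : ℤ) (f : Pol n) : ∃ t : ℕ, f ∈ degLT (d + t) := by
  obtain ⟨N, hN⟩ := (f.support.image xdeg).exists_le
  refine ⟨(N + 1 - d).toNat, fun m hm => ?_⟩
  have := hN _ (Finset.mem_image_of_mem xdeg (MvPolynomial.mem_support_iff.2 hm))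
  omega

/-- There are no zero divisors, so the top component of `g` times `f` cannot vanish; the excess `t`
of a crude degree bound is lowered one step at a time. -/
theorem mem_degLT_of_mul {a d : ℤ} {f g : Pol n} (h0 : f ≠ 0) (hf : f ∈ homog a)
    (h : f * g ∈ degLT (d + a)) : g ∈ degLT d := by
  obtain ⟨t, ht⟩ := exists_mem_degLT d g
  induction t with
  | zero => simpa using ht
  | succ t ih =>
    refine ih ?_
    push_cast at ht
    rw [← add_assoc] at ht
    obtain ⟨q, hq, r, hr, rfl⟩ := exists_homog_add ht
    have h1 : f * q ∈ degLT (a + (d + t)) := by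
      have h2 := sub_mem (degLT_mono (by omega : d + a ≤ d + t + a) h) (mul_mem_degLT hf hr)
      rw [mul_add, add_sub_cancel_right] at h2
      exact degLT_mono (by omega) h2
    have h3 := eq_zero_of_mem (mul_mem_eigen hf hq) h1
    rw [(mul_eq_zero.1 h3).resolve_left h0, zero_add]
    exact hr

/-! ### Homogeneous parts of `opM` and its injectivity in low degree -/

variable (n) in
/-- The number of pairs `i < j`. -/
def numPairs : ℕ := Fintype.card (OrdPair n)

theorem vand_mem : (vand : Pol n) ∈ homog (numPairs n) := by
  rw [mem_homog, derivation_vand]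
  have : ∀ p : OrdPair n, vandErase p.1.1 p.1.2 * (euler (X p.1.1) - euler (X p.1.2)) = vand := by
    intro p
    rw [euler_X, euler_X, mul_comm, mul_vandErase p.2]
  rw [Finset.sum_congr rfl fun p _ => this p, Finset.sum_const, Finset.card_univ, numPairs,
    Int.cast_natCast, Nat.cast_smul_eq_nsmul]

theorem vandErase_mem (p : OrdPair n) :
    (vandErase p.1.1 p.1.2 : Pol n) ∈ homog (numPairs n - 1) :=
  mem_eigen_of_mul (X_sub_ne_zero p.2.ne) (sub_mem (X_mem _) (X_mem _))
    (by rw [mul_vandErase p.2]; exact vand_mem)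

theorem zdx_mem {k : ℤ} {f : Pol n} (hf : f ∈ homog k) : zdx f ∈ homog (k - 1) := by
  rw [zdx_apply]
  refine sum_mem fun i _ => ?_
  simpa using mul_mem_eigen (Z_mem i) (dx_mem hf i)

/-- The part of `opM` of degree `numPairs n - 1` in `x`. -/
def opTop : Module.End ℂ (Pol n) :=
  (2 : ℂ) • (LinearMap.mulLeft ℂ vand * (zdx (n := n) : Pol n →ₗ[ℂ] Pol n) - LinearMap.mulLeft ℂ (zdx vand))

/-- The part of `opM` of degree `numPairs n - 2` in `x`. -/
def opLow : Module.End ℂ (Pol n) := opM - opTop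

theorem opTop_apply (f : Pol n) : opTop f = 2 * (vand * zdx f - zdx vand * f) := by
  rw [opTop, LinearMap.smul_apply, MvPolynomial.smul_eq_C_mul]
  rfl

theorem opM_eq (f : Pol n) : opM f = opTop f + opLow f := by
  rw [opLow, LinearMap.sub_apply, add_sub_cancel]

theorem opLow_apply (f : Pol n) :
    opLow f = vand * ∑ i, dx i (dx i f) - 2 * ∑ i, dx i vand * dx i f := by
  have h : ∀ i, D i (D i f) = dx i (dx i f) + 2 * (Z i * dx i f) + Z i ^ 2 * f := by
    intro i
    simp only [D_apply, map_add, dx_mul, dx_Z]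
    ring
  have h2 : ∀ i, dx i vand * D i f = dx i vand * dx i f + (Z i * dx i vand) * f := by
    intro i
    rw [D_apply]
    ring
  rw [opLow, LinearMap.sub_apply, opM_apply, opA_apply, opTop_apply, zdx_apply, zdx_apply]
  simp only [h, h2, Finset.sum_add_distrib, ← Finset.sum_mul, ← Finset.mul_sum]
  ring

theorem opTop_mem {k : ℤ} {f : Pol n} (hf : f ∈ homog k) :
    opTop f ∈ homog (k + (numPairs n - 1)) := by
  rw [opTop_apply]
  have h1 := mul_mem_eigen vand_mem (zdx_mem hf)
  have h2 := mul_mem_eigen (zdx_mem vand_mem) hf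
  rw [show (numPairs n : ℤ) + (k - 1) = k + (numPairs n - 1) by ring] at h1
  rw [show (numPairs n : ℤ) - 1 + k = k + (numPairs n - 1) by ring] at h2
  simpa using mul_mem_eigen (natCast_mem_eigen euler 2) (sub_mem h1 h2)

theorem opLow_mem {k : ℤ} {f : Pol n} (hf : f ∈ homog k) :
    opLow f ∈ homog (k + (numPairs n - 2)) := by
  rw [opLow_apply]
  refine sub_mem ?_ ?_
  · have h1 := mul_mem_eigen vand_mem
      (sum_mem fun i (_ : i ∈ Finset.univ) => dx_mem (dx_mem hf i) i)
    rwa [show (numPairs n : ℤ) + (k - 1 - 1) = k + (numPairs n - 2) by ring] at h1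
  · have h2 := sum_mem fun i (_ : i ∈ Finset.univ) =>
      mul_mem_eigen (dx_mem (vand_mem (n := n)) i) (dx_mem hf i)
    rw [show (numPairs n : ℤ) - 1 + (k - 1) = k + (numPairs n - 2) by ring] at h2
    simpa using mul_mem_eigen (natCast_mem_eigen euler 2) h2

theorem opTop_mem_degLT {d : ℤ} {f : Pol n} (hf : f ∈ degLT d) :
    opTop f ∈ degLT (d + (numPairs n - 1)) := map_mem_degLT _ (fun _ _ h => opTop_mem h) hf

theorem opLow_mem_degLT {d : ℤ} {f : Pol n} (hf : f ∈ degLT d) :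
    opLow f ∈ degLT (d + (numPairs n - 2)) := map_mem_degLT _ (fun _ _ h => opLow_mem h) hf

theorem opM_mem_degLT {d : ℤ} {f : Pol n} (hf : f ∈ degLT d) :
    opM f ∈ degLT (d + (numPairs n - 1)) := by
  rw [opM_eq]
  exact add_mem (opTop_mem_degLT hf) (degLT_mono (by omega) (opLow_mem_degLT hf))

theorem X_sub_not_dvd_vandErase (p : OrdPair n) :
    ¬(X p.1.1 - X p.1.2 : Pol n) ∣ vandErase p.1.1 p.1.2 := by
  intro h
  obtain ⟨q, hq, hd⟩ := (prime_X_sub p.2.ne).exists_mem_finset_dvd h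
  simp only [Finset.mem_filter, Finset.mem_univ, true_and] at hq
  refine X_sub_not_dvd q.2.ne (fun h => hq (Prod.ext h.1 h.2)) (fun h => ?_) hd
  have h1 := p.2
  have h2 := q.2
  rw [h.1, h.2] at h2
  exact absurd h1 h2.le.not_gt

/-- Modulo `xᵢ - xⱼ` the left side vanishes while `zdx A` becomes `(zᵢ - zⱼ) A / (xᵢ - xⱼ)`, which
this prime does not divide. So each linear factor divides `q`, and they are pairwise non-associate
primes. -/
theorem dvd_of_zdx_eq {q : Pol n} (h : vand * zdx q = zdx vand * q) : vand ∣ q := by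
  classical
  have h1 : ∀ p : OrdPair n, (X p.1.1 - X p.1.2) ∣ q := by
    intro p
    have hp := prime_X_sub p.2.ne
    have e := mul_vandErase p.2
    have hz := congrArg zdx e
    rw [zdx_mul, map_sub, zdx_X, zdx_X] at hz
    have hd : (X p.1.1 - X p.1.2) ∣ (vandErase p.1.1 p.1.2 * (Z p.1.1 - Z p.1.2)) * q := by
      refine ⟨vandErase p.1.1 p.1.2 * zdx q - zdx (vandErase p.1.1 p.1.2) * q, ?_⟩
      linear_combination q * hz - h - zdx q * e
    rcases hp.dvd_or_dvd hd with hd | hd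
    · exact absurd (hp.dvd_or_dvd hd) (not_or.2 ⟨X_sub_not_dvd_vandErase p, Z_sub_not_dvd p.2.ne⟩)
    · exact hd
  rw [vand]
  have : ∀ s : Finset (OrdPair n), ∏ p ∈ s, (X p.1.1 - X p.1.2) ∣ q := by
    intro s
    induction s using Finset.induction_on with
    | empty => simp
    | insert p s hps ih =>
      obtain ⟨g, hg⟩ := ih
      rw [Finset.prod_insert hps, hg, mul_comm]
      refine mul_dvd_mul_left _ ?_
      have hp := prime_X_sub (n := n) p.2.ne
      refine (hp.dvd_or_dvd (hg ▸ h1 p)).resolve_left fun h => ?_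
      obtain ⟨r, hr, hd⟩ := hp.exists_mem_finset_dvd h
      refine X_sub_not_dvd_vandErase p (hd.trans (Finset.dvd_prod_of_mem _ ?_))
      simp only [Finset.mem_filter, Finset.mem_univ, true_and]
      rintro hrp
      exact hps (Subtype.ext hrp ▸ hr)
  exact this Finset.univ

/-- If `opM f` has smaller degree than expected, then so has `f`, provided that the degree of `f`
is less than that of the Vandermonde product. -/
theorem mem_degLT_of_opM {d : ℤ} {f : Pol n} (hd : d < numPairs n) (hf : f ∈ degLT (d + 1))
    (h : opM f ∈ degLT (d + (numPairs n - 1))) : f ∈ degLT d := by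
  obtain ⟨q, hq, r, hr, rfl⟩ := exists_homog_add hf
  have h1 : opTop q ∈ degLT (d + (numPairs n - 1)) := by
    have e : opTop q = opM (q + r) - opM r - opLow q := by
      rw [map_add, opM_eq q]
      ring
    rw [e]
    refine sub_mem (sub_mem h (opM_mem_degLT hr)) ?_
    exact mem_degLT_of_mem_homog (opLow_mem hq) (by omega)
  have h2 := eq_zero_of_mem (opTop_mem hq) h1
  rw [opTop_apply] at h2
  have h3 := (mul_eq_zero.1 h2).resolve_left (by norm_num)
  obtain ⟨g, rfl⟩ := dvd_of_zdx_eq (sub_eq_zero.1 h3)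
  -- The top component is `A g` of degree `d < M`, so `g` has negative degree.
  have h4 := eq_zero_of_mem_homog_neg (mem_eigen_of_mul vand_ne_zero vand_mem hq) (by omega)
  rw [h4, mul_zero, zero_add]
  exact hr

/-- The uniqueness principle behind both the termination of the iteration and the symmetry of its
result. -/
theorem eq_zero_of_opM_eq_zero {f : Pol n} (hf : f ∈ degLT (numPairs n)) (h : opM f = 0) :
    f = 0 := by
  have : ∀ t : ℕ, f ∈ degLT (numPairs n - t) := by
    intro t
    induction t with
    | zero => simpa using hf
    | succ t ih =>
      refine mem_degLT_of_opM (by omega) (degLT_mono (by omega) ih) ?_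
      rw [h]
      exact zero_mem _
  exact eq_zero_of_mem_degLT (this (numPairs n)) (by omega)

/-! ### The iteration from A² to a solution -/

theorem iterate_derivation_mul (d : Derivation ℂ (Pol n) (Pol n)) {a b : Pol n} (hab : d a = b)
    (hb : d b = 0) (f : Pol n) (m : ℕ) :
    d^[m + 1] (a * f) = a * d^[m + 1] f + (m + 1) * b * d^[m] f := by
  induction m with
  | zero => simp [hab]; ring
  | succ m ih =>
    rw [Function.iterate_succ_apply', ih, map_add, d.leibniz, d.leibniz, d.leibniz, hab, hb,
      Function.iterate_succ_apply' d (m + 1), Function.iterate_succ_apply' d m]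
    have : d ((m : Pol n) + 1) = 0 := by
      rw [← Nat.cast_succ]
      exact d.map_natCast _
    rw [this]
    simp only [smul_eq_mul]
    push_cast
    ring

/-- Each factor can be differentiated only once, so as many derivatives as factors hit every factor,
in any of the factorially many orders. -/
theorem iterate_derivation_prod {ι : Type*} [DecidableEq ι] (d : Derivation ℂ (Pol n) (Pol n))
    (a b : ι → Pol n) (hab : ∀ i, d (a i) = b i) (hb : ∀ i, d (b i) = 0) (s : Finset ι) :
    d^[s.card] (∏ i ∈ s, a i) = (s.card.factorial : Pol n) * ∏ i ∈ s, b i ∧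
      d^[s.card + 1] (∏ i ∈ s, a i) = 0 := by
  induction s using Finset.induction_on with
  | empty => simp
  | insert i s hi ih =>
    rw [Finset.card_insert_of_notMem hi, Finset.prod_insert hi, Finset.prod_insert hi,
      iterate_derivation_mul d (hab i) (hb i), iterate_derivation_mul d (hab i) (hb i),
      Function.iterate_succ_apply' d (s.card + 1), ih.2, ih.1, map_zero, Nat.factorial_succ]
    push_cast
    constructor <;> ring

/-- The Vandermonde product `∏_{i<j} (zᵢ - zⱼ)`. -/
def vandZ : Pol n := ∏ p : OrdPair n, (Z p.1.1 - Z p.1.2)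

theorem iterate_zdx_vand :
    zdx^[numPairs n] (vand : Pol n) = ((numPairs n).factorial : Pol n) * vandZ ∧
      zdx^[numPairs n + 1] (vand : Pol n) = 0 :=
  iterate_derivation_prod zdx (fun p : OrdPair n => X p.1.1 - X p.1.2)
    (fun p => Z p.1.1 - Z p.1.2) (fun p => by simp) (fun p => by simp) Finset.univ

variable (n) in
theorem exists_seq : ∃ Q : ℕ → Pol n, Q 0 = vand ^ 2 ∧ ∀ j, vand * Q (j + 1) = opM (Q j) := by
  have h : ∀ f : {f : Pol n // IsQuasiInvariant f}, ∃ g : {f : Pol n // IsQuasiInvariant f},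
      vand * (g : Pol n) = opM f := fun f => by
    obtain ⟨g, hg, hg'⟩ := f.2.exists_step
    exact ⟨⟨g, hg'⟩, hg⟩
  choose s hs using h
  refine ⟨fun j => (s^[j] ⟨vand ^ 2, isQuasiInvariant_vand_sq⟩ : _), rfl, fun j => ?_⟩
  beta_reduce
  rw [Function.iterate_succ_apply']
  exact hs _

theorem iterate_zdx_mem (j : ℕ) : zdx^[j] (vand : Pol n) ∈ homog (numPairs n - j) := by
  induction j with
  | zero => simpa using vand_mem
  | succ j ih =>
    rw [Function.iterate_succ_apply']
    have := zdx_mem ih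
    rwa [show (numPairs n : ℤ) - j - 1 = numPairs n - (j + 1 : ℕ) by push_cast; ring] at this

/-- The top part of `opM` sends `A h` to `2 A² zdx h`, so dividing by `A` turns `A h` into `2 A zdx
h` up to lower degree. -/
theorem seq_sub_mem {Q : ℕ → Pol n} (h0 : Q 0 = vand ^ 2)
    (hQ : ∀ j, vand * Q (j + 1) = opM (Q j)) (j : ℕ) :
    Q j - 2 ^ j * (vand * zdx^[j] vand) ∈ degLT (2 * numPairs n - j) := by
  induction j with
  | zero =>
    have e : Q 0 - 2 ^ 0 * (vand * zdx^[0] vand) = 0 := by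
      rw [h0, Function.iterate_zero_apply]
      ring
    rw [e]
    exact zero_mem _
  | succ j ih =>
    set h := zdx^[j] (vand : Pol n) with hh
    have hm := iterate_zdx_mem (n := n) j
    rw [← hh] at hm
    rw [Function.iterate_succ_apply', ← hh]
    refine mem_degLT_of_mul vand_ne_zero vand_mem ?_
    have hpow : ((2 : Pol n) ^ j) ∈ homog 0 := by
      simpa using natCast_mem_eigen (euler (n := n)) (2 ^ j)
    have h1 : 2 ^ j * (vand * h) ∈ homog (2 * (numPairs n : ℤ) - j) := by
      have := mul_mem_eigen hpow (mul_mem_eigen vand_mem hm)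
      rwa [show (0 : ℤ) + (numPairs n + (numPairs n - j)) = 2 * numPairs n - j by ring] at this
    have e : vand * (Q (j + 1) - 2 ^ (j + 1) * (vand * zdx h)) =
        opM (Q j - 2 ^ j * (vand * h)) + opLow (2 ^ j * (vand * h)) := by
      have h2 : zdx ((2 : Pol n) ^ j) = 0 := by
        have := (zdx (n := n)).map_natCast (2 ^ j)
        simpa using this
      rw [mul_sub, hQ, map_sub, opM_eq (2 ^ j * (vand * h)), opTop_apply, zdx_mul, zdx_mul, h2]
      ring
    rw [e]
    refine add_mem (degLT_mono ?_ (opM_mem_degLT ih))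
      (mem_degLT_of_mem_homog (opLow_mem h1) ?_)
    · push_cast; omega
    · push_cast; omega

/-- Beyond `j = M` the leading term is gone, so `Q j` has degree below `2M - j` and is eventually
zero. All these degrees are below `M`, so injectivity of `opM` carries the vanishing back to `j = M
+ 1`. -/
theorem seq_eq_zero {Q : ℕ → Pol n} (h0 : Q 0 = vand ^ 2)
    (hQ : ∀ j, vand * Q (j + 1) = opM (Q j)) : Q (numPairs n + 1) = 0 := by
  have hmem : ∀ j : ℕ, numPairs n < j → Q j ∈ degLT (2 * numPairs n - j) := by
    intro j hj
    have h1 := seq_sub_mem h0 hQ j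
    have h2 : zdx^[j] (vand : Pol n) = 0 := by
      obtain ⟨k, rfl⟩ := Nat.exists_eq_add_of_lt hj
      rw [show numPairs n + k + 1 = k + (numPairs n + 1) by ring, Function.iterate_add_apply,
        iterate_zdx_vand.2]
      exact iterate_map_zero zdx k
    rwa [h2, mul_zero, mul_zero, sub_zero] at h1
  have key : ∀ t : ℕ, Q (numPairs n + 1 + t) = 0 → Q (numPairs n + 1) = 0 := by
    intro t
    induction t with
    | zero => exact id
    | succ t ih =>
      intro h
      refine ih (eq_zero_of_opM_eq_zero (degLT_mono ?_ (hmem _ (by omega))) ?_)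
      · push_cast; omega
      · rw [← hQ, add_assoc, h, mul_zero]
  -- At index `2M + 1` the degree bound is `-1`.
  refine key (numPairs n) (eq_zero_of_mem_degLT (hmem _ (by omega)) ?_)
  push_cast
  omega

/-! ### Exchange of x and z, and bispectrality -/

variable (n) in
/-- The exchange of the `x`-variables and the `z`-variables. -/
def exch : Pol n ≃ₐ[ℂ] Pol n := MvPolynomial.renameEquiv ℂ (Equiv.sumComm (Fin n) (Fin n))

theorem exch_apply (f : Pol n) : exch n f = MvPolynomial.rename Sum.swap f := rfl

@[simp] theorem exch_X (i : Fin n) : exch n (X i) = Z i := by simp [exch_apply, X, Z]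

@[simp] theorem exch_Z (i : Fin n) : exch n (Z i) = X i := by simp [exch_apply, X, Z]

@[simp] theorem exch_exch (f : Pol n) : exch n (exch n f) = f := by
  rw [exch_apply, exch_apply, MvPolynomial.rename_rename]
  simp

theorem exch_dx (i : Fin n) (f : Pol n) : exch n (dx i f) = dz i (exch n f) :=
  (MvPolynomial.pderiv_rename Sum.swap_leftInverse.injective (Sum.inl i) f).symm

theorem exch_dz (i : Fin n) (f : Pol n) : exch n (dz i f) = dx i (exch n f) := by
  rw [← exch_exch (dx i _), exch_dx, exch_exch]

@[simp] theorem exch_vand : exch n vand = vandZ := by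
  rw [vand, vandZ, map_prod]
  simp only [map_sub, exch_X]

@[simp] theorem exch_vandZ : exch n vandZ = vand := by rw [← exch_vand, exch_exch]

/-- The operator `∂/∂zᵢ + xᵢ`. -/
def D' (i : Fin n) : Module.End ℂ (Pol n) :=
  (dz i : Pol n →ₗ[ℂ] Pol n) + LinearMap.mulLeft ℂ (X i)

theorem D'_apply (i : Fin n) (f : Pol n) : D' i f = dz i f + X i * f := rfl

theorem exch_D (i : Fin n) (f : Pol n) : exch n (D i f) = D' i (exch n f) := by
  rw [D_apply, D'_apply, map_add, map_mul, exch_dx, exch_Z]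

/-- The conjugate of an operator by the exchange of variables. -/
def conj (T : Module.End ℂ (Pol n)) : Module.End ℂ (Pol n) :=
  (exch n).toLinearMap * T * (exch n).toLinearMap

theorem conj_apply (T : Module.End ℂ (Pol n)) (f : Pol n) :
    conj T f = exch n (T (exch n f)) := rfl

theorem exch_conj (T : Module.End ℂ (Pol n)) (f : Pol n) : exch n (conj T f) = T (exch n f) := by
  rw [conj_apply, exch_exch]

theorem conj_opA : conj (opA (n := n)) = LinearMap.mulLeft ℂ vandZ * ∑ i, D' i * D' i -
    (2 : ℂ) • ∑ i, LinearMap.mulLeft ℂ (dz i vandZ) * D' i := by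
  refine LinearMap.ext fun f => ?_
  rw [conj_apply, opA_apply, LinearMap.sub_apply, Module.End.mul_apply, LinearMap.smul_apply,
    LinearMap.sum_apply, LinearMap.sum_apply, LinearMap.mulLeft_apply, MvPolynomial.smul_eq_C_mul]
  simp only [map_sub, map_mul, map_sum, exch_D, exch_dx, exch_exch, exch_vand]
  rw [map_ofNat]
  rfl

theorem conj_opM (f : Pol n) : conj opM f = conj opA f - vandZ * (∑ i, X i ^ 2) * f := by
  rw [conj_apply, opM_apply, map_sub, ← conj_apply]
  simp

theorem dx_vandZ (i : Fin n) : dx i (vandZ : Pol n) = 0 := by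
  rw [vandZ, derivation_prod]
  simp

theorem dz_vand (i : Fin n) : dz i (vand : Pol n) = 0 := by
  rw [vand, derivation_prod]
  simp

theorem commute_D_D' (i j : Fin n) : Commute (D i) (D' j) := by
  refine LinearMap.ext fun f => ?_
  simp only [Module.End.mul_apply, D_apply, D'_apply, map_add, dx_mul, dz_mul, dx_X, dz_Z, dx_dz]
  simp only [eq_comm (a := i)]
  ring

theorem commute_D_mul {i : Fin n} {g : Pol n} (h : dx i g = 0) :
    Commute (D i) (LinearMap.mulLeft ℂ g) := by
  refine LinearMap.ext fun f => ?_
  simp only [Module.End.mul_apply, LinearMap.mulLeft_apply, D_mul, h]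
  ring

theorem commute_mul_D' {i : Fin n} {g : Pol n} (h : dz i g = 0) :
    Commute (LinearMap.mulLeft ℂ g) (D' i) := by
  refine LinearMap.ext fun f => ?_
  simp only [Module.End.mul_apply, LinearMap.mulLeft_apply, D'_apply, dz_mul, h]
  ring

theorem commute_mul_mul (g h : Pol n) :
    Commute (LinearMap.mulLeft ℂ g) (LinearMap.mulLeft ℂ h) :=
  LinearMap.ext fun f => mul_left_comm g h f

theorem commute_opA_of {T : Module.End ℂ (Pol n)} (h1 : ∀ i, Commute (D i) T)
    (h2 : Commute (LinearMap.mulLeft ℂ vand) T)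
    (h3 : ∀ i, Commute (LinearMap.mulLeft ℂ (dx i vand)) T) : Commute opA T :=
  (h2.mul_left (Commute.sum_left _ _ _ fun i _ => (h1 i).mul_left (h1 i))).sub_left
    ((Commute.sum_left _ _ _ fun i _ => (h3 i).mul_left (h1 i)).smul_left _)

theorem commute_opA_mul {g : Pol n} (h : ∀ i, dx i g = 0) :
    Commute opA (LinearMap.mulLeft ℂ g) :=
  commute_opA_of (fun i => commute_D_mul (h i)) (commute_mul_mul _ _)
    fun _ => commute_mul_mul _ _

theorem opA_mul {g : Pol n} (h : ∀ i, dx i g = 0) (f : Pol n) : opA (g * f) = g * opA f :=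
  LinearMap.congr_fun (commute_opA_mul h) f

/-- After conjugation by `exp (∑ xᵢ zᵢ)` one operator involves only `x` and `∂/∂x`, the other only
`z` and `∂/∂z`. -/
theorem commute_opA_conj : Commute (opA (n := n)) (conj opA) := by
  have h : ∀ T : Module.End ℂ (Pol n), (∀ i, Commute T (D' i)) →
      Commute T (LinearMap.mulLeft ℂ vandZ) →
      (∀ i, Commute T (LinearMap.mulLeft ℂ (dz i vandZ))) → Commute T (conj opA) := by
    intro T h1 h2 h3
    rw [conj_opA]
    exact (h2.mul_right (Commute.sum_right _ _ _ fun i _ => (h1 i).mul_right (h1 i))).sub_right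
      ((Commute.sum_right _ _ _ fun i _ => (h3 i).mul_right (h1 i)).smul_right _)
  refine commute_opA_of (fun i => h _ (commute_D_D' i) (commute_D_mul (dx_vandZ i))
    fun j => commute_D_mul ?_) (h _ (fun i => commute_mul_D' (dz_vand i)) (commute_mul_mul _ _)
    fun _ => commute_mul_mul _ _) fun i => h _ (fun j => commute_mul_D' ?_) (commute_mul_mul _ _)
    fun _ => commute_mul_mul _ _
  · rw [dx_dz, dx_vandZ, map_zero]
  · rw [← dx_dz, dz_vand, map_zero]

/-- The commutator with `∑ xᵢ²` is essentially an Euler operator. The scalar `2n - 4M` comes from `Δ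
∑ xᵢ² = 2n` and Euler's relation `∑ xᵢ ∂ᵢA = M A`. -/
theorem opA_sum_sq_mul (f : Pol n) :
    opA ((∑ i, X i ^ 2) * f) = (∑ i, X i ^ 2) * opA f +
      vand * (4 * ∑ i, X i * D i f + (2 * (n : Pol n) - 4 * (numPairs n : Pol n)) * f) := by
  have h0 : ∀ i : Fin n, dx i (∑ j, X j ^ 2) = 2 * X i := by
    intro i
    rw [map_sum]
    simp only [sq, dx_mul, dx_X, mul_ite, mul_one, mul_zero, Finset.sum_add_distrib,
      Finset.sum_ite_eq', Finset.mem_univ, if_true]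
    ring
  set ρ : Pol n := ∑ j, X j ^ 2 with hρ
  have h1 : ∀ i : Fin n, D i (ρ * f) = ρ * D i f + 2 * (X i * f) := by
    intro i
    rw [D_mul, h0]
    ring
  have h2 : ∀ i : Fin n, D i (D i (ρ * f)) = ρ * D i (D i f) + 4 * (X i * D i f) + 2 * f := by
    intro i
    have h3 : (2 : Pol n) * (X i * f) = (2 * X i) * f := by ring
    have h4 : dx i ((2 : Pol n) * X i) = 2 := by
      rw [dx_mul, dx_X, if_pos rfl]
      have : dx i (2 : Pol n) = 0 := (dx i).map_natCast 2
      rw [this]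
      ring
    rw [h1, map_add, D_mul, h0, h3, D_mul, h4]
    ring
  have h5 : ∑ i, X i * dx i (vand : Pol n) = (numPairs n : Pol n) * vand := by
    rw [← euler_apply, mem_homog.1 vand_mem, Int.cast_natCast, Nat.cast_smul_eq_nsmul, nsmul_eq_mul]
  have h6 : ∀ i : Fin n, dx i vand * D i (ρ * f) =
      ρ * (dx i vand * D i f) + 2 * (X i * dx i vand) * f := by
    intro i
    rw [h1]
    ring
  rw [opA_apply, opA_apply]
  simp only [h2, h6, Finset.sum_add_distrib, ← Finset.mul_sum, ← Finset.sum_mul, h5,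
    Finset.sum_const, Finset.card_univ, Fintype.card_fin, nsmul_eq_mul]
  ring

theorem conj_opA_sum_sq_mul (f : Pol n) :
    conj opA ((∑ i, Z i ^ 2) * f) = (∑ i, Z i ^ 2) * conj opA f +
      vandZ * (4 * ∑ i, Z i * D' i f + (2 * (n : Pol n) - 4 * (numPairs n : Pol n)) * f) := by
  have h := congrArg (exch n) (opA_sum_sq_mul (exch n f))
  have e : (∑ i, X i ^ 2) * exch n f = exch n ((∑ i, Z i ^ 2) * f) := by
    simp only [map_mul, map_sum, map_pow, exch_Z]
  rw [e, ← conj_apply] at h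
  rw [h]
  simp only [map_add, map_sub, map_mul, map_sum, map_pow, exch_X, exch_vand, exch_D, exch_exch,
    map_natCast, map_ofNat, conj_apply]

/-- The Euler derivation of the `z`-variables. -/
def eulerZ : Derivation ℂ (Pol n) (Pol n) := ∑ i, Z i • dz i

theorem eulerZ_apply (f : Pol n) : eulerZ f = ∑ i, Z i * dz i f := by
  rw [eulerZ, derivation_sum_apply]
  rfl

theorem exch_euler (f : Pol n) : exch n (euler f) = eulerZ (exch n f) := by
  rw [euler_apply, eulerZ_apply, map_sum]
  simp only [map_mul, exch_X, exch_dx]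

/-- Bispectrality: `opM` annihilates the conjugate of `opM` applied to a solution of degree `0`. -/
theorem opM_conj_opM {Q : Pol n} (h : opM Q = 0) (he : euler Q = eulerZ Q) :
    opM (conj opM Q) = 0 := by
  have hA : opA Q = vand * (∑ i, Z i ^ 2) * Q := by
    rw [opM_apply] at h
    exact sub_eq_zero.1 h
  have e1 : opA (conj opA Q) = conj opA (opA Q) := LinearMap.congr_fun commute_opA_conj Q
  have e2 : conj opA (vand * ((∑ i, Z i ^ 2) * Q)) = vand * conj opA ((∑ i, Z i ^ 2) * Q) := by
    have h2 := opA_mul (n := n) (g := vandZ) dx_vandZ (exch n ((∑ i, Z i ^ 2) * Q))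
    rw [conj_apply, map_mul, exch_vand, h2, map_mul, exch_vandZ]
    rfl
  -- Both sums contain `(∑ xᵢ zᵢ) Q`; what remains is the difference of the two Euler derivations.
  -- It is all that the two commutators leave over.
  have e3 : ∑ i, X i * D i Q - ∑ i, Z i * D' i Q = 0 := by
    rw [← sub_eq_zero, euler_apply, eulerZ_apply] at he
    rw [← he]
    simp only [D_apply, D'_apply, mul_add, Finset.sum_add_distrib]
    have : ∀ i : Fin n, X i * (Z i * Q) = Z i * (X i * Q) := fun i => by ring
    simp only [this]
    ring
  have e4 : opA (vandZ * ((∑ i, X i ^ 2) * Q)) = vandZ * opA ((∑ i, X i ^ 2) * Q) :=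
    opA_mul dx_vandZ _
  rw [opM_apply, conj_opM, map_sub, e1, mul_assoc vandZ, e4, opA_sum_sq_mul, hA, mul_assoc vand, e2,
    conj_opA_sum_sq_mul]
  linear_combination (-4 * vand * vandZ) * e3

/-! ### The two leading terms -/

/-- The sum of the two leading terms of the symmetric solution. -/
def leading (n : ℕ) : Pol n :=
  vand * vandZ - 2 * ∑ p : OrdPair n, vandErase p.1.1 p.1.2 * exch n (vandErase p.1.1 p.1.2)

theorem exch_leading : exch n (leading n) = leading n := by
  simp only [leading, map_sub, map_mul, map_sum, exch_vand, exch_vandZ, exch_exch, map_ofNat]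
  simp only [mul_comm]

theorem dx_exch_of_dz {f : Pol n} (h : ∀ i, dz i f = 0) (i : Fin n) : dx i (exch n f) = 0 := by
  rw [← exch_dz, h, map_zero]

theorem dz_vandErase (p : OrdPair n) (i : Fin n) : dz i (vandErase p.1.1 p.1.2 : Pol n) = 0 := by
  rw [vandErase, derivation_prod]
  simp

theorem mul_exch_vandErase (p : OrdPair n) :
    (Z p.1.1 - Z p.1.2) * exch n (vandErase p.1.1 p.1.2) = vandZ := by
  have h := congrArg (exch n) (mul_vandErase p.2)
  simpa only [map_mul, map_sub, exch_X, exch_vand] using h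

theorem zdx_eq_zero {g : Pol n} (h : ∀ i, dx i g = 0) : zdx g = 0 := by
  rw [zdx_apply]
  simp [h]

theorem opLow_mul {g : Pol n} (h : ∀ i, dx i g = 0) (f : Pol n) : opLow (g * f) = g * opLow f := by
  have h1 : ∀ (i : Fin n) (f : Pol n), dx i (g * f) = g * dx i f := fun i f => by
    rw [dx_mul, h, mul_zero, add_zero]
  rw [opLow_apply, opLow_apply]
  simp only [h1, mul_left_comm _ g, ← Finset.mul_sum]
  ring

theorem opTop_mul {g : Pol n} (h : ∀ i, dx i g = 0) (f : Pol n) : opTop (g * f) = g * opTop f := by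
  rw [opTop_apply, opTop_apply, zdx_mul, zdx_eq_zero h]
  ring

theorem opTop_vandErase (p : OrdPair n) : opTop (vandErase p.1.1 p.1.2) =
    -2 * (Z p.1.1 - Z p.1.2) * vandErase p.1.1 p.1.2 ^ 2 := by
  have e := mul_vandErase p.2
  have hz := congrArg zdx e
  rw [zdx_mul, map_sub, zdx_X, zdx_X] at hz
  rw [opTop_apply, ← hz, ← e]
  ring

/-- The correction term in `leading` is chosen so that its top part cancels the low part of `opM
(A(x) A(z))`, which the differential equation of `A` computes. The remainder has degree `2M - 3`. -/
theorem opM_leading : opM (leading n) =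
    -2 * ∑ p : OrdPair n, exch n (vandErase p.1.1 p.1.2) * opLow (vandErase p.1.1 p.1.2) := by
  have h1 : opTop (vand * vandZ : Pol n) = 0 := by
    rw [mul_comm, opTop_mul dx_vandZ, opTop_apply]
    ring
  have h2 : opLow (vand * vandZ : Pol n) =
      vandZ * (-4 * ∑ p : OrdPair n, vandErase p.1.1 p.1.2 ^ 2) := by
    rw [mul_comm, opLow_mul dx_vandZ, opLow_apply, ← vand_identity]
    simp only [sq]
  have h3 : ∀ p : OrdPair n, opM (vandErase p.1.1 p.1.2 * exch n (vandErase p.1.1 p.1.2)) =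
      -2 * vandZ * vandErase p.1.1 p.1.2 ^ 2 +
        exch n (vandErase p.1.1 p.1.2) * opLow (vandErase p.1.1 p.1.2) := by
    intro p
    have hd := dx_exch_of_dz (dz_vandErase p)
    rw [mul_comm, opM_eq, opTop_mul hd, opLow_mul hd, opTop_vandErase, ← mul_exch_vandErase p]
    ring
  have h4 : leading n = vand * vandZ - (2 : ℂ) •
      ∑ p : OrdPair n, vandErase p.1.1 p.1.2 * exch n (vandErase p.1.1 p.1.2) := by
    rw [leading, MvPolynomial.smul_eq_C_mul]
    rfl
  rw [h4, map_sub, map_smul, map_sum, opM_eq (vand * vandZ), h1, h2, MvPolynomial.smul_eq_C_mul]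
  simp only [h3, Finset.sum_add_distrib, ← Finset.mul_sum]
  rw [show (MvPolynomial.C (2 : ℂ) : Pol n) = 2 from rfl]
  ring

theorem exch_mem_homog_zero {f : Pol n} (h : ∀ i, dz i f = 0) : exch n f ∈ homog 0 := by
  rw [mem_homog, euler_apply]
  simp [dx_exch_of_dz h]

theorem dz_opLow {f : Pol n} (h : ∀ i, dz i f = 0) (i : Fin n) : dz i (opLow f) = 0 := by
  have h1 : ∀ g : Pol n, (∀ i, dz i g = 0) → ∀ j i, dz i (dx j g) = 0 := by
    intro g hg j i
    rw [← dx_dz, hg, map_zero]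
  have h2 : dz i (2 : Pol n) = 0 := (dz i).map_natCast 2
  rw [opLow_apply, map_sub, dz_mul, dz_mul, map_sum, map_sum, h2, dz_vand]
  simp [h1 f h, h1 _ (h1 f h _), h1 _ dz_vand]

/-- As `leading` is symmetric, this is the exchange of `opM (leading n)`. There `opLow (vandErase
..)` is free of `z`, so after the exchange only `vandErase` carries `x`, in degree `M - 1`. -/
theorem conj_opM_leading_mem : conj opM (leading n) ∈ degLT (numPairs n) := by
  rw [conj_apply, exch_leading, opM_leading, map_mul, map_sum]
  have h : ∑ p : OrdPair n, exch n (exch n (vandErase p.1.1 p.1.2) *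
      opLow (vandErase p.1.1 p.1.2)) ∈ homog (numPairs n - 1) := by
    refine sum_mem fun p _ => ?_
    rw [map_mul, exch_exch]
    simpa using mul_mem_eigen (vandErase_mem p) (exch_mem_homog_zero (dz_opLow (dz_vandErase p)))
  have h2 : exch n (-2 : Pol n) * ∑ p : OrdPair n, exch n (exch n (vandErase p.1.1 p.1.2) *
      opLow (vandErase p.1.1 p.1.2)) = (-2 : ℂ) • ∑ p : OrdPair n,
      exch n (exch n (vandErase p.1.1 p.1.2) * opLow (vandErase p.1.1 p.1.2)) := by
    rw [MvPolynomial.smul_eq_C_mul, map_neg, map_neg, map_ofNat]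
    rfl
  rw [h2]
  exact mem_degLT_of_mem_homog (Submodule.smul_mem _ _ h) (by omega)

theorem exch_zdx_exch_mem {k : ℤ} {f : Pol n} (hf : f ∈ homog k) :
    exch n (zdx (exch n f)) ∈ homog (k + 1) := by
  rw [zdx_apply, map_sum]
  refine sum_mem fun i _ => ?_
  rw [map_mul, exch_Z, exch_dx, exch_exch, add_comm]
  exact mul_mem_eigen (X_mem i) (dz_mem hf i)

theorem vandZ_mem : (vandZ : Pol n) ∈ homog 0 := by
  rw [← exch_vand]
  exact exch_mem_homog_zero dz_vand

theorem conj_opTop_mem {k : ℤ} {f : Pol n} (hf : f ∈ homog k) :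
    conj opTop f ∈ homog (k + 1) := by
  have h1 := mul_mem_eigen vandZ_mem (exch_zdx_exch_mem hf)
  have h2 := mul_mem_eigen (exch_zdx_exch_mem vandZ_mem) hf
  rw [zero_add] at h1
  rw [show (0 : ℤ) + 1 + k = k + 1 by ring] at h2
  have h3 := mul_mem_eigen (natCast_mem_eigen euler 2) (sub_mem h1 h2)
  rw [zero_add] at h3
  rw [conj_apply, opTop_apply, map_mul, map_ofNat]
  simpa using h3

theorem conj_opLow_mem {k : ℤ} {f : Pol n} (hf : f ∈ homog k) : conj opLow f ∈ homog (k + 0) := by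
  rw [conj_apply, opLow_apply]
  simp only [map_sub, map_mul, map_sum, exch_dx, exch_exch, exch_vand, map_ofNat]
  refine sub_mem ?_ ?_
  · have h1 := mul_mem_eigen vandZ_mem
      (sum_mem fun i (_ : i ∈ Finset.univ) => dz_mem (dz_mem hf i) i)
    rwa [add_comm] at h1
  · have h2 := sum_mem fun i (_ : i ∈ Finset.univ) =>
      mul_mem_eigen (dz_mem (vandZ_mem (n := n)) i) (dz_mem hf i)
    rw [add_comm] at h2
    simpa using mul_mem_eigen (natCast_mem_eigen euler 2) h2

theorem conj_opM_mem_degLT {d : ℤ} {f : Pol n} (hf : f ∈ degLT d) :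
    conj opM f ∈ degLT (d + 1) := by
  have e : conj opM f = conj opTop f + conj opLow f := by
    rw [conj_apply, opM_eq, map_add]
    rfl
  rw [e]
  exact add_mem (map_mem_degLT _ (fun _ _ h => conj_opTop_mem h) hf)
    (degLT_mono (by omega) (map_mem_degLT _ (fun _ _ h => conj_opLow_mem h) hf))

/-! ### Bidegrees -/

/-- A polynomial of bidegree difference `0` has the same degree in `z` as in `x`. -/
theorem exch_mem_degLT {d : ℤ} {f : Pol n} (he : euler f = eulerZ f) (hf : f ∈ degLT d) :
    exch n f ∈ degLT d := by
  intro m hm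
  have hc : ∀ (m : Fin n ⊕ Fin n →₀ ℕ) (g : Pol n),
      (exch n g).coeff m = g.coeff (m.mapDomain Sum.swap) := by
    intro m g
    have := MvPolynomial.coeff_rename_mapDomain Sum.swap Sum.swap_leftInverse.injective g
      (m.mapDomain Sum.swap)
    rwa [← Finsupp.mapDomain_comp, Sum.swap_swap_eq, Finsupp.mapDomain_id] at this
  have h1 := congrArg (fun g => (exch n g).coeff m) he
  have h2 : exch n (eulerZ f) = euler (exch n f) := by
    rw [← exch_exch (euler _), exch_euler, exch_exch]
  simp only [h2] at h1
  rw [hc, coeff_euler, coeff_euler, ← hc] at h1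
  have h3 : xdeg (m.mapDomain Sum.swap) = xdeg m := by exact_mod_cast mul_right_cancel₀ hm h1
  rw [← h3]
  exact hf _ (by rwa [← hc])

/-- The bidegree difference. -/
def weight : Derivation ℂ (Pol n) (Pol n) := euler - eulerZ

theorem weight_apply (f : Pol n) : weight f = euler f - eulerZ f := rfl

theorem weight_Z_mem (i : Fin n) : (Z i : Pol n) ∈ eigen weight (-1) := by
  rw [mem_eigen, weight_apply, eulerZ_apply]
  simp

theorem weight_dx_mem {k : ℤ} {f : Pol n} (hf : f ∈ eigen weight k) (i : Fin n) :
    dx i f ∈ eigen weight (k - 1) := by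
  rw [mem_eigen] at *
  have h := congrArg (dx i) hf
  have h2 : dx i (eulerZ f) = eulerZ (dx i f) := by
    rw [eulerZ_apply, eulerZ_apply, map_sum]
    simp [dx_dz]
  have h3 : dx i (euler f) = euler (dx i f) + dx i f := by
    rw [euler_apply, euler_apply, map_sum]
    simp only [dx_mul, dx_X, Finset.sum_add_distrib, mul_ite, mul_one, mul_zero,
      Finset.sum_ite_eq', Finset.mem_univ, if_true, dx_comm i]
  rw [weight_apply, map_sub, h2, h3, Derivation.map_smul] at h
  rw [weight_apply]
  push_cast
  rw [sub_smul, ← h, one_smul]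
  ring

theorem weight_vand_mem : (vand : Pol n) ∈ eigen weight (numPairs n) := by
  rw [mem_eigen, weight_apply, mem_homog.1 vand_mem, eulerZ_apply]
  simp [dz_vand]

theorem weight_D_mem {k : ℤ} {f : Pol n} (hf : f ∈ eigen weight k) (i : Fin n) :
    D i f ∈ eigen weight (k - 1) := by
  have h := mul_mem_eigen (weight_Z_mem i) hf
  rw [neg_add_eq_sub] at h
  exact add_mem (weight_dx_mem hf i) h

theorem weight_opM_mem {k : ℤ} {f : Pol n} (hf : f ∈ eigen weight k) :
    opM f ∈ eigen weight (numPairs n + (k - 2)) := by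
  have h1 := mul_mem_eigen weight_vand_mem
    (sum_mem fun i (_ : i ∈ Finset.univ) => weight_D_mem (weight_D_mem hf i) i)
  have h2 := mul_mem_eigen (natCast_mem_eigen weight 2) (sum_mem fun i (_ : i ∈ Finset.univ) =>
    mul_mem_eigen (weight_dx_mem (weight_vand_mem (n := n)) i) (weight_D_mem hf i))
  have h3 := mul_mem_eigen (mul_mem_eigen weight_vand_mem
    (sum_mem fun i (_ : i ∈ Finset.univ) =>
      mul_mem_eigen (weight_Z_mem (n := n) i) (weight_Z_mem i))) hf
  rw [show (numPairs n : ℤ) + (k - 1 - 1) = numPairs n + (k - 2) by ring] at h1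
  rw [show (0 : ℤ) + (numPairs n - 1 + (k - 1)) = numPairs n + (k - 2) by ring] at h2
  rw [show (numPairs n : ℤ) + (-1 + -1) + k = numPairs n + (k - 2) by ring] at h3
  rw [opM_apply, opA_apply]
  simp only [← sq] at h3
  exact sub_mem (sub_mem h1 (by simpa using h2)) h3

/-- `opM` shifts the weight by `M - 2` and division by `A` by `-M`. The weight starts at `2M` and so
reaches `0` at `j = M`. -/
theorem weight_seq_mem {Q : ℕ → Pol n} (h0 : Q 0 = vand ^ 2)
    (hQ : ∀ j, vand * Q (j + 1) = opM (Q j)) (j : ℕ) :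
    Q j ∈ eigen weight (2 * numPairs n - 2 * j) := by
  induction j with
  | zero =>
    have := mul_mem_eigen weight_vand_mem (weight_vand_mem (n := n))
    rw [h0, sq]
    simpa [two_mul] using this
  | succ j ih =>
    have h := weight_opM_mem ih
    rw [← hQ] at h
    have h2 := mem_eigen_of_mul vand_ne_zero weight_vand_mem h
    rwa [show (numPairs n : ℤ) + (2 * numPairs n - 2 * j - 2) - numPairs n =
      2 * numPairs n - 2 * (j + 1 : ℕ) by push_cast; ring] at h2

/-! ### Symmetry of the solution -/

variable (n) in
/-- The factor `2 ^ M M!`, where `M` is the number of pairs. -/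
def normFactor : ℕ := 2 ^ numPairs n * (numPairs n).factorial

theorem seq_numPairs_sub_mem {Q : ℕ → Pol n} (h0 : Q 0 = vand ^ 2)
    (hQ : ∀ j, vand * Q (j + 1) = opM (Q j)) :
    Q (numPairs n) - (normFactor n : Pol n) * (vand * vandZ) ∈ degLT (numPairs n) := by
  have h := seq_sub_mem h0 hQ (numPairs n)
  rw [iterate_zdx_vand.1, show 2 * (numPairs n : ℤ) - numPairs n = numPairs n by ring] at h
  rw [normFactor]
  push_cast
  convert h using 1
  ring

theorem seq_numPairs_ne_zero {Q : ℕ → Pol n} (h0 : Q 0 = vand ^ 2)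
    (hQ : ∀ j, vand * Q (j + 1) = opM (Q j)) : Q (numPairs n) ≠ 0 := by
  intro h
  have h1 := seq_numPairs_sub_mem h0 hQ
  rw [h, zero_sub, neg_mem_iff] at h1
  have h2 := mul_mem_eigen (natCast_mem_eigen euler (normFactor n))
    (mul_mem_eigen vand_mem (vandZ_mem (n := n)))
  rw [zero_add, add_zero] at h2
  have h3 := eq_zero_of_mem h2 h1
  have h4 : (vandZ : Pol n) ≠ 0 := fun h => vand_ne_zero (n := n) (by
    rw [← exch_vandZ, h, map_zero])
  refine mul_ne_zero ?_ (mul_ne_zero vand_ne_zero h4) h3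
  rw [Nat.cast_ne_zero, normFactor]
  positivity

theorem exch_seq_numPairs {Q : ℕ → Pol n} (h0 : Q 0 = vand ^ 2)
    (hQ : ∀ j, vand * Q (j + 1) = opM (Q j)) : exch n (Q (numPairs n)) = Q (numPairs n) := by
  have hM : opM (Q (numPairs n)) = 0 := by rw [← hQ, seq_eq_zero h0 hQ, mul_zero]
  have hw := weight_seq_mem h0 hQ (numPairs n)
  have hr := seq_numPairs_sub_mem h0 hQ
  set q := Q (numPairs n)
  set c : Pol n := (normFactor n : Pol n) with hc
  have hsmul : ∀ f : Pol n, c * f = (normFactor n : ℂ) • f := fun f => by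
    rw [MvPolynomial.smul_eq_C_mul, map_natCast]
  have he : euler q = eulerZ q := by
    rw [sub_self, mem_eigen, Int.cast_zero, zero_smul, weight_apply] at hw
    exact sub_eq_zero.1 hw
  have h1 : q - c * leading n ∈ degLT (numPairs n) := by
    have e : q - c * leading n = (q - c * (vand * vandZ)) + ((2 * normFactor n : ℕ) : Pol n) *
        ∑ p : OrdPair n, vandErase p.1.1 p.1.2 * exch n (vandErase p.1.1 p.1.2) := by
      rw [leading]
      push_cast
      ring
    rw [e]
    refine add_mem hr ?_
    have h := mul_mem_eigen (natCast_mem_eigen euler (2 * normFactor n))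
      (sum_mem fun p (_ : p ∈ Finset.univ) =>
        mul_mem_eigen (vandErase_mem (n := n) p) (exch_mem_homog_zero (dz_vandErase p)))
    exact mem_degLT_of_mem_homog h (by omega)
  -- Since `opM q = 0` and `opM (leading n)` has degree only `2M - 3`, the degree bound improves by
  -- one. This makes room for the degree that `conj opM` adds.
  have h2 : q - c * leading n ∈ degLT (numPairs n - 1) := by
    refine mem_degLT_of_opM (by omega) (degLT_mono (by omega) h1) ?_
    rw [map_sub, hM, zero_sub, neg_mem_iff, hsmul, map_smul, opM_leading]
    refine Submodule.smul_mem _ _ ?_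
    have e : ∀ S : Pol n, -2 * S = (-2 : ℂ) • S := fun S => by
      rw [MvPolynomial.smul_eq_C_mul, map_neg]
      rfl
    rw [e]
    refine Submodule.smul_mem _ _ (sum_mem fun p _ => ?_)
    exact mem_degLT_of_mem_homog (mul_mem_eigen (exch_mem_homog_zero (dz_vandErase p))
      (opLow_mem (vandErase_mem p))) (by omega)
  have h3 : conj opM q = 0 := by
    refine eq_zero_of_opM_eq_zero ?_ (opM_conj_opM hM he)
    have e : conj opM q = conj opM (q - c * leading n) + c * conj opM (leading n) := by
      rw [hsmul, hsmul, map_sub, map_smul]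
      ring
    rw [e]
    refine add_mem (degLT_mono (sub_add_cancel _ _).le (conj_opM_mem_degLT h2)) ?_
    rw [hsmul]
    exact Submodule.smul_mem _ _ conj_opM_leading_mem
  have h4 : opM (exch n q) = 0 := by rw [← exch_conj, h3, map_zero]
  -- The leading part `c A(x) A(z)` is symmetric, and exchanging the rest preserves its degree bound
  -- because its bidegree difference is `0`.
  have h5 : q - exch n q = 0 := by
    refine eq_zero_of_opM_eq_zero ?_ (by rw [map_sub, hM, h4, sub_zero])
    have e : q - exch n q = (q - c * (vand * vandZ)) - exch n (q - c * (vand * vandZ)) := by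
      rw [map_sub, map_mul, map_mul, exch_vand, exch_vandZ, hc, map_natCast]
      ring
    rw [e]
    refine sub_mem hr (exch_mem_degLT ?_ hr)
    have h6 : vand * vandZ ∈ eigen (weight (n := n)) 0 := by
      rw [mem_eigen, weight_apply, mem_homog.1 (mul_mem_eigen vand_mem vandZ_mem)]
      have h7 := congrArg (exch n) (mem_homog.1 (mul_mem_eigen (vand_mem (n := n)) vandZ_mem))
      rw [exch_euler, map_smul, map_mul, exch_vand, exch_vandZ, mul_comm vandZ] at h7
      rw [h7]
      simp
    have h8 : weight (q - c * (vand * vandZ)) = 0 := by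
      rw [mem_eigen, Int.cast_zero, zero_smul] at h6
      rw [map_sub, hsmul, Derivation.map_smul, h6, weight_apply, he]
      simp
    exact sub_eq_zero.1 h8
  exact (sub_eq_zero.1 h5).symm

/-! ### Translation invariance -/

/-- The substitution `xᵢ ↦ xᵢ - xₒ`, `zᵢ ↦ zᵢ - zₒ`. -/
def center (o : Fin n) : Pol n →ₐ[ℂ] Pol n :=
  MvPolynomial.aeval (Sum.elim (fun i => X i - X o) fun i => Z i - Z o)

@[simp] theorem center_X (o i : Fin n) : center o (X i) = X i - X o := by simp [center, X]

@[simp] theorem center_Z (o i : Fin n) : center o (Z i) = Z i - Z o := by simp [center, Z]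

theorem dx_center {o i : Fin n} (h : i ≠ o) (f : Pol n) :
    dx i (center o f) = center o (dx i f) := by
  induction f using MvPolynomial.induction_on with
  | C c =>
    have h1 : center o (MvPolynomial.C c) = MvPolynomial.C c := (center o).commutes c
    have h2 : dx i (MvPolynomial.C c) = 0 := (dx i).map_algebraMap c
    rw [h1, h2, map_zero]
  | add f g hf hg => rw [map_add, map_add, map_add, map_add, hf, hg]
  | mul_X f k hf =>
    rcases k with k | k
    · change dx i (center o (f * X k)) = center o (dx i (f * X k))
      rw [map_mul, dx_mul, dx_mul, hf, map_add, map_mul, map_mul, center_X, map_sub, dx_X, dx_X,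
        if_neg h.symm]
      split_ifs <;> simp
    · change dx i (center o (f * Z k)) = center o (dx i (f * Z k))
      rw [map_mul, dx_mul, dx_mul, hf, map_add, map_mul, map_mul, center_Z, map_sub, dx_Z, dx_Z]
      simp

/-- The derivation `∑ᵢ ∂/∂xᵢ`. -/
def shift : Derivation ℂ (Pol n) (Pol n) := ∑ i, dx i

theorem shift_apply (f : Pol n) : shift f = ∑ i, dx i f := derivation_sum_apply _ _ _

/-- Polynomials in the differences `xᵢ - xₒ`, `zᵢ - zₒ`. -/
def centered (o : Fin n) : Subalgebra ℂ (Pol n) where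
  carrier := {f | center o f = f ∧ shift f = 0}
  add_mem' := by
    rintro f g ⟨hf, hf'⟩ ⟨hg, hg'⟩
    exact ⟨by rw [map_add, hf, hg], by rw [map_add, hf', hg', add_zero]⟩
  mul_mem' := by
    rintro f g ⟨hf, hf'⟩ ⟨hg, hg'⟩
    exact ⟨by rw [map_mul, hf, hg], by rw [shift.leibniz, hf', hg', smul_zero, smul_zero, add_zero]⟩
  algebraMap_mem' c := ⟨(center o).commutes c, shift.map_algebraMap c⟩

theorem X_sub_mem_centered (o i j : Fin n) : X i - X j ∈ centered o := by
  refine ⟨by simp, ?_⟩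
  simp [shift_apply]

theorem vand_mem_centered (o : Fin n) : vand ∈ centered o :=
  prod_mem fun p _ => X_sub_mem_centered o p.1.1 p.1.2

/-- The substitution commutes with `∂/∂xᵢ` only for `i ≠ o`; the remaining derivative is minus the
sum of the others since `shift f = 0`. -/
theorem dx_mem_centered {o : Fin n} {f : Pol n} (hf : f ∈ centered o) (i : Fin n) :
    dx i f ∈ centered o := by
  have h1 : ∀ i ≠ o, center o (dx i f) = dx i f := fun i hi => by rw [← dx_center hi, hf.1]
  refine ⟨?_, ?_⟩
  · by_cases h : i = o
    · subst h
      have h2 : dx i f = -∑ j ∈ Finset.univ.erase i, dx j f := by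
        have := hf.2
        rw [shift_apply, ← Finset.add_sum_erase _ _ (Finset.mem_univ i)] at this
        exact eq_neg_of_add_eq_zero_left this
      rw [h2, map_neg, map_sum]
      exact congrArg _ (Finset.sum_congr rfl fun j hj => h1 j (Finset.ne_of_mem_erase hj))
    · exact h1 i h
  · rw [shift_apply]
    simp only [dx_comm _ i]
    rw [← map_sum, ← shift_apply, hf.2, map_zero]

/-- Replacing `zᵢ` by `zᵢ - zₒ` changes the sum by `zₒ · shift f = 0`. -/
theorem zdx_mem_centered {o : Fin n} {f : Pol n} (hf : f ∈ centered o) :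
    zdx f ∈ centered o := by
  refine ⟨?_, ?_⟩
  · have h : ∀ i, center o (dx i f) = dx i f := fun i => (dx_mem_centered hf i).1
    rw [zdx_apply, map_sum]
    simp only [map_mul, center_Z, h, sub_mul, Finset.sum_sub_distrib]
    rw [← Finset.mul_sum, ← shift_apply, hf.2, mul_zero, sub_zero]
  · rw [zdx_apply, map_sum]
    refine Finset.sum_eq_zero fun i _ => ?_
    rw [shift.leibniz, (dx_mem_centered hf i).2, shift_apply]
    simp

theorem opM_mem_centered {o : Fin n} {f : Pol n} (hf : f ∈ centered o) :
    opM f ∈ centered o := by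
  have h2 : (2 : Pol n) ∈ centered o := natCast_mem _ 2
  have hv := vand_mem_centered o
  rw [opM_eq, opTop_apply, opLow_apply]
  exact add_mem (mul_mem h2 (sub_mem (mul_mem hv (zdx_mem_centered hf))
      (mul_mem (zdx_mem_centered hv) hf)))
    (sub_mem (mul_mem hv (sum_mem fun i _ => dx_mem_centered (dx_mem_centered hf i) i))
      (mul_mem h2 (sum_mem fun i _ => mul_mem (dx_mem_centered hv i) (dx_mem_centered hf i))))

theorem mem_centered_of_mul {o : Fin n} {f g : Pol n} (h0 : f ≠ 0) (hf : f ∈ centered o)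
    (h : f * g ∈ centered o) : g ∈ centered o := by
  obtain ⟨h1, h2⟩ := h
  rw [map_mul, hf.1] at h1
  rw [shift.leibniz, hf.2, smul_zero, add_zero, smul_eq_mul] at h2
  exact ⟨mul_left_cancel₀ h0 h1, (mul_eq_zero.1 h2).resolve_left h0⟩

theorem seq_mem_centered {Q : ℕ → Pol n} (h0 : Q 0 = vand ^ 2)
    (hQ : ∀ j, vand * Q (j + 1) = opM (Q j)) (o : Fin n) (j : ℕ) : Q j ∈ centered o := by
  induction j with
  | zero =>
    rw [h0]
    exact pow_mem (vand_mem_centered o) 2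
  | succ j ih =>
    refine mem_centered_of_mul vand_ne_zero (vand_mem_centered o) ?_
    rw [hQ]
    exact opM_mem_centered ih

/-! ### From polynomials in x and z to differential operators -/

variable (n) in
/-- The inclusion of the polynomials in `x` and `z` into the symbols of differential operators,
with `zᵢ` the symbol of `∂ᵢ`. -/
def symbol : Pol n →ₐ[ℂ] DiffOp n :=
  MvPolynomial.aeval (Sum.elim (fun i => MvPolynomial.C (RatFun.x i)) MvPolynomial.X)

@[simp] theorem symbol_X (i : Fin n) : symbol n (X i) = MvPolynomial.C (RatFun.x i) := by
  simp [symbol, X]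

@[simp] theorem symbol_Z (i : Fin n) : symbol n (Z i) = MvPolynomial.X i := by
  simp [symbol, Z]

open RatFun

theorem toEnd_symbol_Z_mul (i : Fin n) (f : Pol n) :
    (symbol n (Z i * f)).toEnd = (symbol n f).toEnd * pd i := by
  rw [map_mul, symbol_Z, mul_comm, DiffOp.toEnd_mul_X]

/-- The Leibniz rule: moving `∂ᵢ` to the right past the coefficients differentiates them once. -/
theorem pd_mul_toEnd_symbol (i : Fin n) (f : Pol n) :
    pd i * (symbol n f).toEnd = (symbol n (D i f)).toEnd := by
  rw [D_apply, map_add, DiffOp.toEnd_add, toEnd_symbol_Z_mul]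
  induction f using MvPolynomial.induction_on with
  | C c =>
    have h1 : symbol n (MvPolynomial.C c) = MvPolynomial.C (algebraMap ℂ (RatFun n) c) :=
      (symbol n).commutes c
    have h2 : dx i (MvPolynomial.C c) = 0 := (dx i).map_algebraMap c
    have h3 : pd i (algebraMap ℂ (RatFun n) c) = 0 := pderivFun_algebraMap i c
    rw [h1, h2, map_zero, DiffOp.toEnd_zero, zero_add, DiffOp.toEnd_C, pd_mulOp, h3, mulOp_zero,
      add_zero]
  | add f g hf hg =>
    rw [map_add, map_add, map_add, DiffOp.toEnd_add, DiffOp.toEnd_add, mul_add, add_mul, hf, hg]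
    abel
  | mul_X f k hf =>
    rcases k with k | k
    · change pd i * (symbol n (f * X k)).toEnd = (symbol n (dx i (f * X k))).toEnd +
        (symbol n (f * X k)).toEnd * pd i
      rw [mul_comm f, dx_mul, map_add, map_mul, map_mul, map_mul, symbol_X, DiffOp.toEnd_C_mul,
        DiffOp.toEnd_add, DiffOp.toEnd_C_mul, ← mul_assoc, pd_mulOp, add_mul, mul_assoc, hf, pd_x,
        dx_X]
      split_ifs
      · simp only [map_one, mul_one, mulOp_one, one_mul, mul_add, mul_assoc]
        abel
      · simp only [map_zero, mul_zero, mulOp_zero, zero_mul, mul_add, mul_assoc,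
          DiffOp.toEnd_zero]
        abel
    · change pd i * (symbol n (f * Z k)).toEnd = (symbol n (dx i (f * Z k))).toEnd +
        (symbol n (f * Z k)).toEnd * pd i
      rw [mul_comm f, dx_mul, dx_Z, mul_zero, add_zero, toEnd_symbol_Z_mul, toEnd_symbol_Z_mul,
        ← mul_assoc, hf, add_mul, mul_assoc, mul_assoc, (pd_comm i k).eq]

variable (n) in
/-- The Vandermonde product as a polynomial in `x`. -/
def vandPoly : MvPolynomial (Fin n) ℂ :=
  ∏ p : OrdPair n, (MvPolynomial.X p.1.1 - MvPolynomial.X p.1.2)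

theorem rename_vandPoly : MvPolynomial.rename Sum.inl (vandPoly n) = vand := by
  rw [vandPoly, vand, map_prod]
  simp [X]

theorem dx_rename (i : Fin n) (a : MvPolynomial (Fin n) ℂ) :
    dx i (MvPolynomial.rename Sum.inl a) = MvPolynomial.rename Sum.inl (MvPolynomial.pderiv i a) :=
  MvPolynomial.pderiv_rename Sum.inl_injective i a

theorem symbol_rename (a : MvPolynomial (Fin n) ℂ) :
    symbol n (MvPolynomial.rename Sum.inl a) = MvPolynomial.C (ofPoly a) := by
  induction a using MvPolynomial.induction_on with
  | C c =>
    rw [MvPolynomial.rename_C]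
    exact (symbol n).commutes c
  | add a b ha hb =>
    rw [map_add, map_add, ha, hb, ← map_add]
    exact congrArg _ (map_add (algebraMap _ (RatFun n)) a b).symm
  | mul_X a i ha =>
    rw [map_mul, map_mul, ha, MvPolynomial.rename_X]
    refine (congrArg _ (symbol_X i)).trans ?_
    rw [← map_mul]
    exact congrArg _ (map_mul (algebraMap _ (RatFun n)) a (MvPolynomial.X i)).symm

variable (n) in
/-- The Vandermonde product as a rational function of `x`. -/
def vandRat : RatFun n := ofPoly (vandPoly n)

theorem symbol_vand : symbol n vand = MvPolynomial.C (vandRat n) := by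
  rw [← rename_vandPoly, symbol_rename, vandRat]

theorem symbol_dx_vand (i : Fin n) :
    symbol n (dx i vand) = MvPolynomial.C (pd i (vandRat n)) := by
  rw [← rename_vandPoly, dx_rename, symbol_rename, vandRat, pd_ofPoly]

theorem symbol_dx_dx_vand (i : Fin n) :
    symbol n (dx i (dx i vand)) = MvPolynomial.C (pd i (pd i (vandRat n))) := by
  rw [← rename_vandPoly, dx_rename, dx_rename, symbol_rename, vandRat, pd_ofPoly, pd_ofPoly]

theorem vandRat_eq : vandRat n = ∏ p : OrdPair n, (x p.1.1 - x p.1.2) := by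
  rw [vandRat, ofPoly, vandPoly, map_prod]
  simp only [map_sub]
  rfl

theorem x_sub_ne_zero {i j : Fin n} (h : i ≠ j) : x i - x j ≠ 0 := by
  have := ofPoly_ne_zero (MvPolynomial.prime_X_sub_X h).ne_zero
  rw [ofPoly, map_sub] at this
  exact this

theorem vandRat_ne_zero : vandRat n ≠ 0 := by
  rw [vandRat_eq]
  exact Finset.prod_ne_zero_iff.2 fun p _ => x_sub_ne_zero p.2.ne

theorem symbol_vandErase (p : OrdPair n) : symbol n (vandErase p.1.1 p.1.2) =
    MvPolynomial.C (vandRat n * (x p.1.1 - x p.1.2)⁻¹) := by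
  have h0 : (MvPolynomial.C (x p.1.1 - x p.1.2) : DiffOp n) ≠ 0 :=
    (map_ne_zero_iff _ (MvPolynomial.C_injective _ _)).2 (x_sub_ne_zero p.2.ne)
  apply mul_left_cancel₀ h0
  rw [← map_mul, mul_comm (vandRat n), mul_inv_cancel_left₀ (x_sub_ne_zero p.2.ne), ← symbol_vand,
    ← mul_vandErase p.2, map_mul, map_sub, map_sub, symbol_X, symbol_X]

theorem vandRat_identity : vandRat n * ∑ i, pd i (pd i (vandRat n)) -
    2 * ∑ i, pd i (vandRat n) ^ 2 =
      -(vandRat n) ^ 2 * ∑ p : OrdPair n, 4 * ((x p.1.1 - x p.1.2) ^ 2)⁻¹ := by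
  have h := congrArg (symbol n) (vand_identity (n := n))
  simp only [map_sub, map_mul, map_sum, map_pow, symbol_vand, symbol_dx_vand, symbol_dx_dx_vand,
    symbol_vandErase, map_neg, map_ofNat] at h
  apply MvPolynomial.C_injective (Fin n) (RatFun n)
  simp only [map_sub, map_mul, map_sum, map_pow, map_neg, map_ofNat]
  rw [h]
  simp only [Finset.mul_sum]
  refine Finset.sum_congr rfl fun p _ => ?_
  rw [← inv_pow, map_pow]
  ring

theorem toEnd_symbol_opM (f : Pol n) : (symbol n (opM f)).toEnd =
    mulOp (vandRat n) * ∑ i, pd i ^ 2 * (symbol n f).toEnd -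
      (∑ i, mulOp (2 * pd i (vandRat n)) * (pd i * (symbol n f).toEnd)) -
      mulOp (vandRat n) * ((symbol n f).toEnd * ∑ i, pd i ^ 2) := by
  have h1 : ∀ i, (symbol n (D i (D i f))).toEnd = pd i ^ 2 * (symbol n f).toEnd := fun i => by
    rw [sq, mul_assoc, pd_mul_toEnd_symbol, pd_mul_toEnd_symbol]
  have h2 : ∀ i, (symbol n (Z i ^ 2 * f)).toEnd = (symbol n f).toEnd * pd i ^ 2 := fun i => by
    rw [sq, mul_assoc, toEnd_symbol_Z_mul, toEnd_symbol_Z_mul, mul_assoc, sq]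
  have h3 : symbol n (opM f) = MvPolynomial.C (vandRat n) * ∑ i, symbol n (D i (D i f)) -
      (∑ i, MvPolynomial.C (2 * pd i (vandRat n)) * symbol n (D i f)) -
      MvPolynomial.C (vandRat n) * ∑ i, symbol n (Z i ^ 2 * f) := by
    rw [opM_apply, opA_apply, mul_assoc vand, Finset.sum_mul]
    simp only [map_sub, map_mul, map_sum, symbol_vand, symbol_dx_vand, map_ofNat, Finset.mul_sum,
      mul_assoc]
  rw [h3, DiffOp.toEnd_sub, DiffOp.toEnd_sub, DiffOp.toEnd_C_mul, DiffOp.toEnd_C_mul,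
    DiffOp.toEnd_sum, DiffOp.toEnd_sum, DiffOp.toEnd_sum, Finset.mul_sum _ _ (symbol n f).toEnd]
  simp only [h1, h2, DiffOp.toEnd_C_mul, pd_mul_toEnd_symbol]

/-- The operator with symbol `f / A`, where `A` is the Vandermonde product. -/
def quotOp (f : Pol n) : DiffOp n := MvPolynomial.C (vandRat n)⁻¹ * symbol n f

/-- Dividing the operator identity of `toEnd_symbol_opM` by `A²` gives the claim, because `Δ̃ A⁻¹ =
A⁻¹ Δ - 2 A⁻² ∑ (∂ᵢA) ∂ᵢ` as operators. -/
theorem quotOp_intertwines {f : Pol n} (h : opM f = 0) :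
    (quotOp f).toEnd * Airy.lap n = Airy.lapTilde n * (quotOp f).toEnd := by
  have h0 := toEnd_symbol_opM f
  rw [h, map_zero, DiffOp.toEnd_zero] at h0
  set v := vandRat n with hv
  have hv0 : v ≠ 0 := vandRat_ne_zero
  set u := v⁻¹ with hu
  set q := (symbol n f).toEnd with hq
  have hvu : v * u = 1 := mul_inv_cancel₀ hv0
  have hu1 : ∀ i, pd i u = -(u ^ 2 * pd i v) := by
    intro i
    have h1 := pd_mul i v u
    have h2 : pd i (1 : RatFun n) = 0 := by
      have := pderivFun_algebraMap i (1 : ℂ)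
      rwa [map_one] at this
    rw [hvu, h2] at h1
    linear_combination (-u) * h1 - (pd i u) * hvu
  have hu2 : ∀ i, pd i (pd i u) = 2 * u ^ 3 * pd i v ^ 2 - u ^ 2 * pd i (pd i v) := by
    intro i
    rw [hu1, map_neg, pd_mul, sq, pd_mul, hu1]
    ring
  -- This says that `Δ̃` annihilates `u = A⁻¹`, so no zeroth-order term is left in `Δ̃ A⁻¹`.
  have hsum : ∑ i, pd i (pd i u) = u * ∑ p : OrdPair n, 4 * ((x p.1.1 - x p.1.2) ^ 2)⁻¹ := by
    have h1 := vandRat_identity (n := n)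
    rw [← hv] at h1
    simp only [hu2, Finset.sum_sub_distrib, ← Finset.mul_sum] at h1 ⊢
    linear_combination (-u ^ 3) * h1 +
      (u ^ 2 * ∑ i, pd i (pd i v) + u * (v * u + 1) *
        (4 * ∑ p : OrdPair n, ((x p.1.1 - x p.1.2) ^ 2)⁻¹)) * hvu
  have hD : (quotOp f).toEnd = mulOp u * q := DiffOp.toEnd_C_mul _ _
  have hpd : ∀ i, pd i ^ 2 * mulOp u = mulOp u * pd i ^ 2 -
      mulOp (u ^ 2) * mulOp (2 * pd i v) * pd i + mulOp (pd i (pd i u)) := by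
    intro i
    have e : mulOp (u ^ 2) * mulOp (2 * pd i v) * pd i +
        (mulOp (pd i u) * pd i + mulOp (pd i u) * pd i) = 0 := by
      rw [← mulOp_mul, ← add_mul, ← mulOp_add, ← add_mul, ← mulOp_add, hu1]
      rw [show u ^ 2 * (2 * pd i v) + (-(u ^ 2 * pd i v) + -(u ^ 2 * pd i v)) = 0 by ring,
        mulOp_zero, zero_mul]
    rw [sq, mul_assoc, pd_mulOp, mul_add, ← mul_assoc, pd_mulOp, pd_mulOp, add_mul, mul_assoc]
    linear_combination (norm := abel) e
  have hpot : Airy.pot n * mulOp u = mulOp (∑ i, pd i (pd i u)) := by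
    rw [Airy.pot, ← mulOp_sum, ← mulOp_mul, hsum, mul_comm]
  have hlap : Airy.lapTilde n * mulOp u = mulOp u * (∑ i, pd i ^ 2) -
      mulOp (u ^ 2) * ∑ i, mulOp (2 * pd i v) * pd i := by
    rw [Airy.lapTilde, sub_mul, hpot, Airy.lap, Finset.sum_mul, Finset.sum_congr rfl fun i _ =>
      hpd i, Finset.sum_add_distrib, Finset.sum_sub_distrib, mulOp_sum, Finset.mul_sum,
      Finset.mul_sum]
    simp only [mul_assoc]
    abel
  have huv : mulOp (u ^ 2) * mulOp v = mulOp u := by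
    rw [← mulOp_mul]
    congr 1
    linear_combination u * hvu
  have h1 := congrArg (fun T => mulOp (u ^ 2) * T) h0
  simp only [mul_zero, mul_sub, ← mul_assoc, huv] at h1
  rw [hD, ← mul_assoc, hlap, Airy.lap, sub_mul]
  simp only [mul_assoc, Finset.sum_mul] at h1 ⊢
  simp only [← Finset.sum_mul] at h1 ⊢
  exact (sub_eq_zero.1 h1.symm).symm

/-! ### Coefficients and derivatives in the differences -/

variable (n) in
/-- The operators that are polynomials in the `∂ᵢ - ∂ⱼ` with coefficients rational in the
`xᵢ - xⱼ`. -/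
def diffOps : Subring (DiffOp n) :=
  (MvPolynomial.eval₂Hom (MvPolynomial.C.comp (algebraMap (diffField n) (RatFun n)))
    fun p : OrdPair n => (MvPolynomial.X p.1.1 - MvPolynomial.X p.1.2 : DiffOp n)).range

theorem isPolyInDifferences_of_mem {D : DiffOp n} (h : D ∈ diffOps n) :
    D.IsPolyInDifferences := by
  obtain ⟨P, hP⟩ := h
  exact ⟨P, hP.symm⟩

theorem C_mem_diffOps {a : RatFun n} (h : a ∈ diffField n) : MvPolynomial.C a ∈ diffOps n :=
  ⟨MvPolynomial.C ⟨a, h⟩, by simp⟩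

theorem X_sub_mem_diffOps (i j : Fin n) :
    (MvPolynomial.X i - MvPolynomial.X j : DiffOp n) ∈ diffOps n := by
  have h : ∀ i j : Fin n, i < j → (MvPolynomial.X i - MvPolynomial.X j : DiffOp n) ∈ diffOps n :=
    fun i j hij => ⟨MvPolynomial.X ⟨(i, j), hij⟩, by simp⟩
  rcases lt_trichotomy i j with hij | rfl | hij
  · exact h i j hij
  · rw [sub_self]
    exact zero_mem _
  · rw [← neg_sub]
    exact neg_mem (h j i hij)

theorem x_sub_mem_diffField (i j : Fin n) : x i - x j ∈ diffField n :=
  IntermediateField.subset_adjoin _ _ ⟨(i, j), rfl⟩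

theorem symbol_center_mem (o : Fin n) (f : Pol n) : symbol n (center o f) ∈ diffOps n := by
  induction f using MvPolynomial.induction_on with
  | C c =>
    have h1 : center o (MvPolynomial.C c) = MvPolynomial.C c := (center o).commutes c
    have h2 : symbol n (MvPolynomial.C c) = MvPolynomial.C (algebraMap ℂ (RatFun n) c) :=
      (symbol n).commutes c
    rw [h1, h2]
    exact C_mem_diffOps ((diffField n).algebraMap_mem c)
  | add f g hf hg =>
    rw [map_add, map_add]
    exact add_mem hf hg
  | mul_X f k hf =>
    rw [map_mul, map_mul]
    refine mul_mem hf ?_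
    rcases k with k | k
    · change symbol n (center o (X k)) ∈ _
      rw [center_X, map_sub, symbol_X, symbol_X, ← map_sub]
      exact C_mem_diffOps (x_sub_mem_diffField k o)
    · change symbol n (center o (Z k)) ∈ _
      rw [center_Z, map_sub, symbol_Z, symbol_Z]
      exact X_sub_mem_diffOps k o

theorem quotOp_isPolyInDifferences {o : Fin n} {f : Pol n} (hf : f ∈ centered o) :
    (quotOp f).IsPolyInDifferences := by
  refine isPolyInDifferences_of_mem (mul_mem (C_mem_diffOps (inv_mem ?_)) ?_)
  · rw [vandRat_eq]
    exact prod_mem fun p _ => x_sub_mem_diffField _ _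
  · rw [← hf.1]
    exact symbol_center_mem o f

/-! ### The wave factor and the existence of the operator -/

variable (n) in
/-- The inclusion of polynomials in `x` and `z` into the rational functions. -/
def toRat : Pol n →+* RatFun₂ n := algebraMap (Pol n) (RatFun₂ n)

theorem swap_toRat (f : Pol n) : RatFun₂.swap (toRat n f) = toRat n (exch n f) :=
  IsFractionRing.ringEquivOfRingEquiv_algebraMap _ f

theorem ofX_ofPoly (a : MvPolynomial (Fin n) ℂ) :
    RatFun₂.ofX (ofPoly a) = toRat n (MvPolynomial.rename Sum.inl a) :=
  IsLocalization.map_eq (M := nonZeroDivisors (MvPolynomial (Fin n) ℂ))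
    (T := nonZeroDivisors (Pol n))
    (nonZeroDivisors_le_comap_nonZeroDivisors_of_injective _
      (MvPolynomial.rename_injective _ Sum.inl_injective)) a

theorem eval₂_symbol (f : Pol n) :
    MvPolynomial.eval₂ RatFun₂.ofX RatFun₂.z (symbol n f) = toRat n f := by
  induction f using MvPolynomial.induction_on with
  | C c =>
    have h2 : symbol n (MvPolynomial.C c) = MvPolynomial.C (ofPoly (MvPolynomial.C c)) :=
      (symbol n).commutes c
    rw [h2, MvPolynomial.eval₂_C, ofX_ofPoly, MvPolynomial.rename_C]
  | add f g hf hg => rw [map_add, MvPolynomial.eval₂_add, hf, hg, map_add]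
  | mul_X f k hf =>
    rw [map_mul, MvPolynomial.eval₂_mul, hf, map_mul]
    refine congrArg (toRat n f * ·) ?_
    rcases k with k | k
    · change MvPolynomial.eval₂ RatFun₂.ofX RatFun₂.z (symbol n (X k)) = _
      rw [symbol_X, MvPolynomial.eval₂_C, x, ofX_ofPoly, MvPolynomial.rename_X]
    · change MvPolynomial.eval₂ RatFun₂.ofX RatFun₂.z (symbol n (Z k)) = _
      rw [symbol_Z, MvPolynomial.eval₂_X]
      rfl

theorem waveFactor_quotOp (f : Pol n) :
    (quotOp f).waveFactor = (toRat n vandZ)⁻¹ * ((toRat n vand)⁻¹ * toRat n f) := by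
  have h : ∏ p : OrdPair n, (RatFun₂.z p.1.1 - RatFun₂.z p.1.2)⁻¹ = (toRat n vandZ)⁻¹ := by
    rw [Finset.prod_inv_distrib, vandZ, map_prod]
    simp only [map_sub]
    rfl
  rw [DiffOp.waveFactor, quotOp, MvPolynomial.eval₂_mul, MvPolynomial.eval₂_C, eval₂_symbol, h,
    map_inv₀, vandRat, ofX_ofPoly, rename_vandPoly]

theorem swap_waveFactor_quotOp {f : Pol n} (hf : exch n f = f) :
    RatFun₂.swap (quotOp f).waveFactor = (quotOp f).waveFactor := by
  rw [waveFactor_quotOp, map_mul, map_mul, map_inv₀, map_inv₀, swap_toRat, swap_toRat, swap_toRat,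
    hf, exch_vand, exch_vandZ]
  ring

theorem symbol_injective : Function.Injective (symbol n) := by
  intro f g h
  have h1 := congrArg (MvPolynomial.eval₂ RatFun₂.ofX RatFun₂.z) h
  rw [eval₂_symbol, eval₂_symbol] at h1
  exact IsFractionRing.injective (Pol n) (RatFun₂ n) h1

theorem quotOp_ne_zero {f : Pol n} (hf : f ≠ 0) : quotOp f ≠ 0 :=
  mul_ne_zero ((map_ne_zero_iff _ (MvPolynomial.C_injective _ _)).2 (inv_ne_zero vandRat_ne_zero))
    ((map_ne_zero_iff _ symbol_injective).2 hf)

variable (n) in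
theorem exists_isChalykhVeselov (o : Fin n) : ∃ D : DiffOp n, D.IsChalykhVeselov := by
  obtain ⟨Q, h0, hQ⟩ := exists_seq n
  have hM : opM (Q (numPairs n)) = 0 := by rw [← hQ, seq_eq_zero h0 hQ, mul_zero]
  exact ⟨quotOp (Q (numPairs n)),
    DiffOp.toEnd_ne_zero (quotOp_ne_zero (seq_numPairs_ne_zero h0 hQ)),
    quotOp_isPolyInDifferences (seq_mem_centered h0 hQ o (numPairs n)),
    quotOp_intertwines hM,
    swap_waveFactor_quotOp (exch_seq_numPairs h0 hQ)⟩

end Pol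
end

theorem theorem2 (n : ℕ) (hn : 2 ≤ n) :
    (∃ D : DiffOp n, D.IsChalykhVeselov) ∧
    (∀ D : DiffOp n, D.IsPolyInDifferences →
      D.toEnd * Airy.lap n = Airy.lapTilde n * D.toEnd →
      D.toEnd * Airy.ham n = Airy.hamTilde n * D.toEnd) :=
  ⟨Pol.exists_isChalykhVeselov n ⟨0, by omega⟩, fun _ hD h => hD.intertwines_ham h⟩
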